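/- Let $\ell\ge 3$ be an integer, let $\mathbb{F}_q$ be a finite field with $q\equiv 1 \pmod{2\ell}$, and let $\varepsilon>0$. For $d\ge 0$ let $\mathcal{M}_d$ be the set of monic polynomials of degree $d$ in $\mathbb{F}_q[t]$ and $\mathcal{H}_d\subseteq\mathcal{M}_d$ the subset of square-free ones. Fix an isomorphism $\Omega$ from the group of $\ell$-th roots of unity in $\mathbb{F}_q^*$ to the group $\mu_\ell$ of $\ell$-th roots of unity in $\mathbb{C}^*$. For $a\in\mathbb{F}_q[t]$ and $\pi$ monic irreducible, let $\left(\frac{a}{\pi}\right)_\ell=0$ if $\pi\mid a$, and otherwise let $\left(\frac{a}{\pi}\right)_\ell$ be the unique $\alpha\in\mu_\ell$ with $a^{(q^{\deg\pi}-1)/\ell}\equiv\Omega^{-1}(\alpha)\pmod\pi$. For monic $c=\pi_1^{e_1}\cdots\pi_k^{e_k}$, with the $\pi_i$ distinct monic irreducible polynomials, put $\left(\frac{a}{c}\right)_\ell=\prod_i\left(\frac{a}{\pi_i}\right)_\ell^{e_i}$. Then there is a constant $K>0$, depending only on $q$, $\ell$ and $\varepsilon$, such that for all integers $m,n\ge 0$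 and all complex-valued functions $\lambda$ on the monic polynomials in $\mathbb{F}_q[t]$, $$\sum_{M\in\mathcal{M}_m}\left|\sum_{N\in\mathcal{H}_n}\lambda(N)\left(\frac{M}{N}\right)_\ell\right|^2\le K\,q^{\varepsilon(m+n)}\left(q^m+q^{n+m/3}+q^{2(m+n)/3}\right)\sum_{N\in\mathcal{H}_n}|\lambda(N)|^2 .$$ -/

import Mathlib

open Polynomial

namespace LargeSieve

/-- There are only finitely many monic polynomials of a given degree over a finite field. -/
theorem finite_monic (F : Type*) [Field F] [Fintype F] (d : ℕ) :
    {f : F[X] | f.Monic ∧ f.natDegree = d}.Finite := by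
  refine Set.Finite.of_injOn (f := fun f : F[X] => fun i : Fin (d + 1) => f.coeff i)
    (t := Set.univ) (fun _ _ => Set.mem_univ _) ?_ Set.finite_univ
  rintro f ⟨-, hf⟩ g ⟨-, hg⟩ h
  ext i
  by_cases hi : i < d + 1
  · exact congrFun h ⟨i, hi⟩
  · rw [coeff_eq_zero_of_natDegree_lt (by omega), coeff_eq_zero_of_natDegree_lt (by omega)]

/-- `𝓜_d`: the finite set of monic polynomials of degree `d` in `F[t]`. -/
noncomputable def monicDeg (F : Type*) [Field F] [Fintype F] (d : ℕ) : Finset F[X] :=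
  (finite_monic F d).toFinset

open scoped Classical in
/-- `𝓗_d`: the finite set of monic, square-free polynomials of degree `d` in `F[t]`. -/
noncomputable def sqfreeDeg (F : Type*) [Field F] [Fintype F] (d : ℕ) : Finset F[X] :=
  (monicDeg F d).filter Squarefree

open scoped Classical in
/-- The `ℓ`-th residue symbol `(a/π)_ℓ` modulo a monic irreducible `π`, with respect to an
identification `Ω` of the `ℓ`-th roots of unity of `F` with those of `ℂ`: it is `0` if `π ∣ a`, and
otherwise the unique complex `ℓ`-th root of unity `α` with
`a ^ ((q ^ deg π - 1) / ℓ) ≡ Ω⁻¹ α mod π`. (Existence and uniqueness of `α`, when `q ≡ 1 mod ℓ`, is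
`existsUnique_residue` below.) -/
noncomputable def primeSymbol {F : Type*} [Field F] [Fintype F] {ℓ : ℕ}
    (Ω : rootsOfUnity ℓ F ≃* rootsOfUnity ℓ ℂ) (a π : F[X]) : ℂ :=
  if π ∣ a then 0
  else if h : ∃ α : rootsOfUnity ℓ ℂ,
      π ∣ a ^ ((Fintype.card F ^ π.natDegree - 1) / ℓ) - C (((Ω.symm α : rootsOfUnity ℓ F) : Fˣ) : F)
    then ((h.choose : ℂˣ) : ℂ)
  else 0

open scoped Classical in
/-- The `ℓ`-th residue symbol `(a/c)_ℓ` for monic `c = π₁ ^ e₁ ⋯ π_k ^ e_k`, extended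
multiplicatively: the product of `(a/π)_ℓ` over the monic irreducible factors `π` of `c`, counted
with multiplicity. -/
noncomputable def residueSymbol {F : Type*} [Field F] [Fintype F] {ℓ : ℕ}
    (Ω : rootsOfUnity ℓ F ≃* rootsOfUnity ℓ ℂ) (a c : F[X]) : ℂ :=
  ((UniqueFactorizationMonoid.normalizedFactors c).map fun π => primeSymbol Ω a π).prod

/-- The residue symbol at a prime is well defined. -/
theorem existsUnique_residue {F : Type*} [Field F] [Fintype F] {ℓ : ℕ} (hℓ : 0 < ℓ)
    (hq : Fintype.card F ≡ 1 [MOD ℓ]) (Ω : rootsOfUnity ℓ F ≃* rootsOfUnity ℓ ℂ)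
    (a π : F[X]) (hπ : Irreducible π) (ha : ¬ π ∣ a) :
    ∃! α : rootsOfUnity ℓ ℂ,
      π ∣ a ^ ((Fintype.card F ^ π.natDegree - 1) / ℓ)
        - C (((Ω.symm α : rootsOfUnity ℓ F) : Fˣ) : F) := by
  have : Fact (Irreducible π) := ⟨hπ⟩
  have : NeZero ℓ := ⟨hℓ.ne'⟩
  set k := (Fintype.card F ^ π.natDegree - 1) / ℓ with hk
  have key : ∀ z : F, π ∣ a ^ k - C z ↔ AdjoinRoot.mk π a ^ k = AdjoinRoot.of π z := by
    intro z
    rw [← AdjoinRoot.mk_eq_zero, map_sub, map_pow, AdjoinRoot.mk_C, sub_eq_zero]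
  have hinj : Function.Injective (AdjoinRoot.of π) := (AdjoinRoot.of π).injective
  have hdvd : ℓ ∣ Fintype.card F ^ π.natDegree - 1 := by
    have h1 : 1 ≡ Fintype.card F ^ π.natDegree [MOD ℓ] := by
      simpa using (hq.pow π.natDegree).symm
    exact (Nat.modEq_iff_dvd' (Nat.one_le_pow _ _ Fintype.card_pos)).1 h1
  have : Module.Finite F (AdjoinRoot π) := (AdjoinRoot.powerBasis hπ.ne_zero).finite
  have : Finite (AdjoinRoot π) := Module.finite_of_finite F
  let _ : Fintype (AdjoinRoot π) := Fintype.ofFinite _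
  have hcard : Fintype.card (AdjoinRoot π) = Fintype.card F ^ π.natDegree := by
    rw [Module.card_eq_pow_finrank (K := F), (AdjoinRoot.powerBasis hπ.ne_zero).finrank,
      AdjoinRoot.powerBasis_dim]
  have hb : (AdjoinRoot.mk π a ^ k) ^ ℓ = 1 := by
    rw [← pow_mul, hk, Nat.div_mul_cancel hdvd, ← hcard]
    exact FiniteField.pow_card_sub_one_eq_one _ (fun h => ha (AdjoinRoot.mk_eq_zero.1 h))
  have hζ := (Complex.isPrimitiveRoot_exp ℓ hℓ.ne').isUnit_unit hℓ.ne'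
  set u : ℂˣ := _
  have hu : IsPrimitiveRoot u ℓ := hζ
  let α₀ : rootsOfUnity ℓ ℂ := ⟨u, (mem_rootsOfUnity _ _).2 hu.pow_eq_one⟩
  have hα₀ : IsPrimitiveRoot α₀ ℓ :=
    IsPrimitiveRoot.of_map_of_injective (f := (rootsOfUnity ℓ ℂ).subtype) hu
      (Subgroup.subtype_injective _)
  have h1 : IsPrimitiveRoot (Ω.symm α₀) ℓ := hα₀.map_of_injective Ω.symm.injective
  have h2 : IsPrimitiveRoot ((Ω.symm α₀ : rootsOfUnity ℓ F) : Fˣ) ℓ :=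
    h1.map_of_injective (f := (rootsOfUnity ℓ F).subtype) (Subgroup.subtype_injective _)
  have h3 : IsPrimitiveRoot (((Ω.symm α₀ : rootsOfUnity ℓ F) : Fˣ) : F) ℓ :=
    IsPrimitiveRoot.coe_units_iff.2 h2
  have h4 := h3.map_of_injective (f := AdjoinRoot.of π) hinj
  obtain ⟨i, -, hi⟩ := h4.eq_pow_of_pow_eq_one hb
  refine ⟨α₀ ^ i, ?_, ?_⟩
  · refine (key _).2 ?_
    rw [← hi, ← map_pow]
    simp
  · intro β hβ
    have e : AdjoinRoot.of π (((Ω.symm β : rootsOfUnity ℓ F) : Fˣ) : F) =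
        AdjoinRoot.of π (((Ω.symm (α₀ ^ i) : rootsOfUnity ℓ F) : Fˣ) : F) := by
      rw [← (key _).1 hβ, ← hi, ← map_pow]
      simp
    exact Ω.symm.injective (Subtype.ext (Units.ext (hinj e)))

end LargeSieve

/-!
The proof follows Heath-Brown's method for the cubic large sieve, with the Poisson summation formula
over `F[t]`, which is exact. Let `q` be the number of elements of `F`.

*The symbol.* By `resultant_eq_norm` the residue symbol `(M/N)_ℓ` equals `χ (Res (N, M))` for a
multiplicative character `χ` of `F` of order `ℓ` (`residueSymbol_eq_symb`). So it is multiplicative in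
both variables, and since `q ≡ 1 mod 2 ℓ` gives `χ (-1) = 1`, reciprocity is the symmetry of the
resultant up to sign (`symb_comm`). Only `χ ≠ 1`, `χ ^ 2 ≠ 1` and `χ (-1) = 1` are used from here on. Reciprocity
and duality make the problem symmetric when both variables are square-free (`SieveBound.swap`).

*The recursion.* Opening the square leads to the sums of `χ_A (M) * conj (χ_B (M))` over monic `M` of
degree `k`, for coprime `A` and `B` of equal degree `a`. After Poisson summation
(`sum_monicDeg_symb_mul_conj`) the Gauss sum modulo `A * B` splits into a factor depending on `A` and
one depending on `B`, because the symbols between `A` and `B` cancel by reciprocity. What remains is a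
form of the same shape, with outer variable of degree less than `2 a - k` and weight `q ^ (k - a)`.
Common factors of the two moduli and coprimality conditions are removed by Möbius inversion at the cost
of divisor functions (`sieveBound_of_poisson`). For `m ≥ 2 n` the dual sum reduces to
its vanishing zero frequency, which is the orthogonality of the characters.

*Square-free and general outer variables.* Every monic `M` is `A * B ^ 2 * D ^ 3` with `A`, `B`
square-free. If `deg B ≤ deg A`, then `B` and `D` are fixed; they contribute at most
`q ^ (deg B + deg D) ≤ q ^ (m / 3)`. Otherwise `A` and `D` are fixed and contribute as little, and
the outer variable `B` carries `χ ^ 2` and is so short that orthogonality suffices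
(`sieveBound_monicDeg_of_sqfree`). This is where `q ^ (n + m / 3)` comes from.

*The iteration.* Suppose the square-free problem has exponent
`max (m, n, 2 (m + n) / 3, (4 / 3 + η) min (m, n))`. Passing to all `M` when `m ≤ n`, applying the
recursion when `n ≤ m`, and lengthening the outer sum to the point where the dual term is balanced
(`sieveBound_of_add`) gives the same statement with `2 η / 3` in place of `η`
(`LongLargeSieve.sqfree`). Orthogonality and the Cauchy–Schwarz inequality give the case
`η = 5 / 3`, and finitely many steps bring `η` below `ε / 2`.
-/

namespace LargeSieve

open scoped ComplexConjugate

/-! ### Resultants and norms -/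

section Resultant

variable {F : Type*} [Field F]

/-- For monic `N` the resultant does not depend on the formal degree attributed to `M`, so that it
depends only on the residue class of `M`. -/
lemma resultant_monic_of_le {N M : F[X]} (hN : N.Monic) {n : ℕ} (hn : M.natDegree ≤ n) :
    resultant N M N.natDegree n = resultant N M := by
  obtain ⟨k, rfl⟩ := Nat.exists_eq_add_of_le hn
  rw [resultant_add_right_deg _ _ _ _ _ le_rfl, hN.coeff_natDegree, one_pow, one_mul]

lemma resultant_monic_mul_right {N : F[X]} (hN : N.Monic) (M₁ M₂ : F[X]) :
    resultant N (M₁ * M₂) = resultant N M₁ * resultant N M₂ := by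
  rw [← resultant_mul_right _ _ _ _ le_rfl, resultant_monic_of_le hN natDegree_mul_le]

lemma resultant_monic_mul_left {N₁ N₂ : F[X]} (h₁ : N₁.Monic) (h₂ : N₂.Monic) (M : F[X]) :
    resultant (N₁ * N₂) M = resultant N₁ M * resultant N₂ M := by
  rw [← resultant_mul_left _ _ _ _ le_rfl, h₁.natDegree_mul h₂]

lemma resultant_monic_add_mul {N : F[X]} (hN : N.Monic) (M W : F[X]) :
    resultant N (M + N * W) = resultant N M := by
  set n := max (max (M + N * W).natDegree M.natDegree) (W.natDegree + N.natDegree)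
  rw [← resultant_monic_of_le hN (n := n) (by simp [n]),
    ← resultant_monic_of_le hN (M := M) (n := n) (by simp [n]),
    resultant_add_mul_right _ _ _ _ _ (by simp [n]) le_rfl]

lemma resultant_monic_ne_zero_iff {N M : F[X]} (hN : N.Monic) :
    resultant N M ≠ 0 ↔ IsCoprime N M := by
  rw [Ne, resultant_eq_zero_iff]
  simp [hN.ne_zero]

/-- For a monic irreducible `P` the resultant `Res(P, M)` is the norm of the class of `M` from the
residue field `F[t]/P`. -/
lemma resultant_eq_norm [Finite F] {P : F[X]} (hP : P.Monic) [Fact (Irreducible P)] (M : F[X]) :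
    resultant P M = Algebra.norm F (AdjoinRoot.mk P M) := by
  classical
  have hirr : Irreducible P := Fact.out
  have : Module.Finite F (AdjoinRoot P) := (AdjoinRoot.powerBasis hirr.ne_zero).finite
  let E := AlgebraicClosure F
  -- both sides are the product of the values of `M` at the roots of `P` in `E`, which correspond to
  -- the embeddings of `F[t]/P`; the roots are distinct because `F` is perfect
  apply (algebraMap F E).injective
  rw [Algebra.norm_eq_prod_embeddings F E]
  have hsep : (P.map (algebraMap F E)).Separable :=
    (PerfectField.separable_of_irreducible hirr).map
  have h1 := resultant_eq_prod_eval (P.map (algebraMap F E)) (M.map (algebraMap F E)) _ le_rfl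
    (IsAlgClosed.splits _)
  rw [resultant_map_map, natDegree_map, natDegree_map, (hP.map _).leadingCoeff, one_pow,
    one_mul] at h1
  rw [h1]
  have h2 : (P.map (algebraMap F E)).roots = P.aroots E := rfl
  have hnd : (P.aroots E).Nodup := nodup_roots hsep
  have h5 : (P.aroots E).toFinset.val = P.aroots E := by
    rw [Multiset.toFinset_val, hnd.dedup]
  rw [h2, ← h5, ← Finset.prod_eq_multiset_prod, ← Finset.prod_coe_sort]
  refine Fintype.prod_equiv ((Equiv.subtypeEquivRight fun x => Multiset.mem_toFinset).trans (AdjoinRoot.equiv E F P hirr.ne_zero).symm) _ _ ?_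
  intro x
  simp only [Equiv.trans_apply]
  set y : {y // y ∈ P.aroots E} := (Equiv.subtypeEquivRight (fun x => Multiset.mem_toFinset) x : {y // y ∈ P.aroots E})
  have hy : (y : E) = x := rfl
  have h3 : (AdjoinRoot.equiv E F P hirr.ne_zero) ((AdjoinRoot.equiv E F P hirr.ne_zero).symm y) = y :=
    Equiv.apply_symm_apply _ _
  set σ := (AdjoinRoot.equiv E F P hirr.ne_zero).symm y
  have h4 : σ (AdjoinRoot.root P) = x := by
    rw [← hy, ← h3]; rfl
  rw [← h4, ← AdjoinRoot.aeval_eq, ← aeval_algHom_apply, eval_map_algebraMap]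

end Resultant

/-! ### The symbol attached to a character of the constant field -/

section Symbol

variable {F : Type*} [Field F] (χ : MulChar F ℂ)

/-- The symbol `χ(Res(N, M))` attached to a multiplicative character `χ` of the constant field. -/
noncomputable def symb (N M : F[X]) : ℂ := χ (resultant N M)

variable {χ}

lemma symb_one_left (M : F[X]) : symb χ 1 M = 1 := by
  have : resultant (1 : F[X]) M = 1 := by
    rw [resultant_one_left]; simp
  rw [symb, this, map_one]

lemma symb_mul_right {N : F[X]} (hN : N.Monic) (M₁ M₂ : F[X]) :
    symb χ N (M₁ * M₂) = symb χ N M₁ * symb χ N M₂ := by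
  rw [symb, resultant_monic_mul_right hN, map_mul]; rfl

lemma symb_pow_right {N : F[X]} (hN : N.Monic) (M : F[X]) (k : ℕ) :
    symb χ N (M ^ k) = symb χ N M ^ k := by
  induction k with
  | zero => simp [symb]
  | succ k ih => rw [pow_succ, symb_mul_right hN, ih, pow_succ]

lemma symb_mul_left {N₁ N₂ : F[X]} (h₁ : N₁.Monic) (h₂ : N₂.Monic) (M : F[X]) :
    symb χ (N₁ * N₂) M = symb χ N₁ M * symb χ N₂ M := by
  rw [symb, resultant_monic_mul_left h₁ h₂, map_mul]; rfl

lemma symb_add_mul {N : F[X]} (hN : N.Monic) (M W : F[X]) :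
    symb χ N (M + N * W) = symb χ N M := by
  rw [symb, resultant_monic_add_mul hN]; rfl

lemma symb_congr {N M M' : F[X]} (hN : N.Monic) (h : N ∣ M - M') : symb χ N M = symb χ N M' := by
  obtain ⟨W, hW⟩ := h
  rw [← symb_add_mul hN M' W, ← hW]; congr 1; ring

lemma symb_eq_zero {N M : F[X]} (hN : N.Monic) (h : ¬ IsCoprime N M) : symb χ N M = 0 := by
  rw [symb]
  have : resultant N M = 0 := by
    by_contra h0; exact h ((resultant_monic_ne_zero_iff hN).1 h0)
  rw [this, MulChar.map_zero]

/-- Reciprocity: for a character with `χ(-1) = 1` the symbol is symmetric. -/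
lemma symb_comm (hχ : χ (-1) = 1) (N M : F[X]) : symb χ N M = symb χ M N := by
  rw [symb, resultant_comm, map_mul, map_pow, hχ, one_pow, one_mul]; rfl

lemma symb_sq (N M : F[X]) : symb (χ ^ 2) N M = symb χ N M ^ 2 := by
  rw [symb, symb, MulChar.pow_apply' _ two_ne_zero]

variable [Finite F]

lemma norm_symb_of_isCoprime {N M : F[X]} (hN : N.Monic) (h : IsCoprime N M) :
    ‖symb χ N M‖ = 1 := by
  have h0 := (resultant_monic_ne_zero_iff hN).2 h
  have := Fintype.ofFinite F
  have hu : (χ (resultant N M)) ^ (Fintype.card F - 1) = 1 := by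
    rw [← map_pow, FiniteField.pow_card_sub_one_eq_one _ h0, map_one]
  have hc : Fintype.card F - 1 ≠ 0 := by
    have := Fintype.one_lt_card (α := F); omega
  exact Complex.norm_eq_one_of_pow_eq_one hu hc

lemma norm_symb_le_one {N M : F[X]} (hN : N.Monic) : ‖symb χ N M‖ ≤ 1 := by
  by_cases h : IsCoprime N M
  · exact (norm_symb_of_isCoprime hN h).le
  · simp [symb_eq_zero hN h]

lemma symb_mul_conj {N M : F[X]} (hN : N.Monic) (h : IsCoprime N M) :
    symb χ N M * (starRingEnd ℂ) (symb χ N M) = 1 := by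
  rw [Complex.mul_conj, Complex.normSq_eq_norm_sq, norm_symb_of_isCoprime hN h]; simp

/-- A nontrivial character gives a nontrivial symbol modulo every irreducible polynomial. -/
lemma exists_symb_ne_one (hχ : χ ≠ 1) {P : F[X]} (hP : P.Monic) (hirr : Irreducible P) :
    ∃ u, IsCoprime P u ∧ symb χ P u ≠ 1 := by
  have : Fact (Irreducible P) := ⟨hirr⟩
  have : Module.Finite F (AdjoinRoot P) := (AdjoinRoot.powerBasis hirr.ne_zero).finite
  have : Finite (AdjoinRoot P) := Module.finite_of_finite F
  obtain ⟨z, hz⟩ := (MulChar.ne_one_iff).1 hχ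
  obtain ⟨x, hx⟩ := FiniteField.norm_surjective F (AdjoinRoot P) z
  obtain ⟨u, rfl⟩ := AdjoinRoot.mk_surjective x
  rw [← resultant_eq_norm hP] at hx
  refine ⟨u, ?_, ?_⟩
  · rw [← resultant_monic_ne_zero_iff hP, hx]; exact z.ne_zero
  · rw [symb, hx]; exact hz

end Symbol

/-! ### The residue symbol as a resultant symbol -/

section Residue

variable {F : Type*} [Field F] [Fintype F] {ℓ : ℕ}

lemma units_pow_card_sub_one (x : Fˣ) : x ^ (Fintype.card F - 1) = 1 := by
  ext
  simpa using FiniteField.pow_card_sub_one_eq_one (x : F) x.ne_zero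

/-- The character `x ↦ Ω (x ^ ((q - 1) / ℓ))` of the constant field. -/
noncomputable def residueChar (h : ℓ ∣ Fintype.card F - 1)
    (Ω : rootsOfUnity ℓ F ≃* rootsOfUnity ℓ ℂ) : MulChar F ℂ :=
  MulChar.ofUnitHom <| (rootsOfUnity ℓ ℂ).subtype.comp <| Ω.toMonoidHom.comp <|
    (powMonoidHom ((Fintype.card F - 1) / ℓ) : Fˣ →* Fˣ).codRestrict (rootsOfUnity ℓ F)
      fun x => (mem_rootsOfUnity _ _).2 <| by
        rw [powMonoidHom_apply, ← pow_mul, Nat.div_mul_cancel h, units_pow_card_sub_one]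

lemma residueChar_apply (h : ℓ ∣ Fintype.card F - 1) (Ω : rootsOfUnity ℓ F ≃* rootsOfUnity ℓ ℂ)
    (x : Fˣ) (α : rootsOfUnity ℓ F) (hα : (α : Fˣ) = x ^ ((Fintype.card F - 1) / ℓ)) :
    residueChar h Ω x = ((Ω α : ℂˣ) : ℂ) := by
  rw [residueChar, MulChar.ofUnitHom_coe]
  have : (powMonoidHom ((Fintype.card F - 1) / ℓ) : Fˣ →* Fˣ).codRestrict (rootsOfUnity ℓ F)
      (fun x => (mem_rootsOfUnity _ _).2 <| by
        rw [powMonoidHom_apply, ← pow_mul, Nat.div_mul_cancel h, units_pow_card_sub_one]) x = α := Subtype.ext hα.symm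
  simp only [MonoidHom.comp_apply, this]
  rfl

/-- The order of `residueChar` is a multiple of `ℓ`: look at a generator of `Fˣ`. -/
lemma residueChar_pow_ne_one (h : ℓ ∣ Fintype.card F - 1)
    (Ω : rootsOfUnity ℓ F ≃* rootsOfUnity ℓ ℂ) {j : ℕ} (hj : ¬ ℓ ∣ j) :
    residueChar h Ω ^ j ≠ 1 := by
  intro h1
  apply hj
  obtain ⟨g, hg⟩ := IsCyclic.exists_generator (α := Fˣ)
  have hord := orderOf_eq_card_of_forall_mem_zpowers hg
  rw [Nat.card_units, Nat.card_eq_fintype_card] at hord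
  set r := (Fintype.card F - 1) / ℓ
  have hr : r * ℓ = Fintype.card F - 1 := Nat.div_mul_cancel h
  have hc : 0 < Fintype.card F - 1 := by have := Fintype.one_lt_card (α := F); omega
  have hmem : g ^ r ∈ rootsOfUnity ℓ F := by
    rw [mem_rootsOfUnity, ← pow_mul, hr, ← hord, pow_orderOf_eq_one]
  have h2 := residueChar_apply h Ω g ⟨g ^ r, hmem⟩ rfl
  have h3 : (residueChar h Ω ^ j) g = 1 := by rw [h1, MulChar.one_apply_coe]
  have hj0 : j ≠ 0 := by rintro rfl; exact hj (dvd_zero _)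
  rw [MulChar.pow_apply' _ hj0, h2] at h3
  have h4 : Ω (⟨g ^ r, hmem⟩ ^ j) = 1 := by
    rw [map_pow]; ext; push_cast; exact h3
  have h5 := congrArg Subtype.val ((MulEquiv.map_eq_one_iff Ω).1 h4)
  have h6 : g ^ (r * j) = 1 := by rw [pow_mul]; exact h5
  have h7 := orderOf_dvd_of_pow_eq_one h6
  rw [hord, ← hr] at h7
  exact Nat.dvd_of_mul_dvd_mul_left (Nat.pos_of_ne_zero (by rintro h0; rw [h0] at hr; omega)) h7

/-- As `(q - 1) / ℓ` is even, `residueChar` is trivial at `-1`. -/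
lemma residueChar_neg_one (h : 2 * ℓ ∣ Fintype.card F - 1)
    (Ω : rootsOfUnity ℓ F ≃* rootsOfUnity ℓ ℂ) :
    residueChar ((dvd_mul_left ℓ 2).trans h) Ω (-1) = 1 := by
  have hc : 0 < Fintype.card F - 1 := by have := Fintype.one_lt_card (α := F); omega
  obtain ⟨k, hk⟩ := h
  have hℓ : 0 < ℓ := Nat.pos_of_ne_zero (by rintro rfl; simp at hk; omega)
  have h1 : (Fintype.card F - 1) / ℓ = 2 * k := by
    rw [hk, show 2 * ℓ * k = ℓ * (2 * k) by ring, Nat.mul_div_cancel_left _ hℓ]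
  have := residueChar_apply ((dvd_mul_left ℓ 2).trans ⟨k, hk⟩) Ω (-1) 1 (by
    rw [h1, pow_mul]; simp)
  simpa using this

/-- The residue symbol at a prime is a character of the norm from the residue field. -/
lemma primeSymbol_eq_symb (hℓ : 0 < ℓ) (hq : Fintype.card F ≡ 1 [MOD ℓ])
    (h : ℓ ∣ Fintype.card F - 1) (Ω : rootsOfUnity ℓ F ≃* rootsOfUnity ℓ ℂ) (a : F[X]) {π : F[X]}
    (hm : π.Monic) (hπ : Irreducible π) :
    primeSymbol Ω a π = symb (residueChar h Ω) π a := by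
  classical
  by_cases ha : π ∣ a
  · rw [primeSymbol, if_pos ha, symb_eq_zero hm]
    rw [hπ.coprime_iff_not_dvd]; exact not_not_intro ha
  have hex := (existsUnique_residue hℓ hq Ω a π hπ ha).exists
  rw [primeSymbol, if_neg ha, dif_pos hex]
  have hα := hex.choose_spec
  set α := hex.choose
  have : Fact (Irreducible π) := ⟨hπ⟩
  have : Module.Finite F (AdjoinRoot π) := (AdjoinRoot.powerBasis hπ.ne_zero).finite
  have : Finite (AdjoinRoot π) := Module.finite_of_finite F
  have hcop : IsCoprime π a := hπ.coprime_iff_not_dvd.2 ha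
  have hne := (resultant_monic_ne_zero_iff hm).2 hcop
  rw [symb]
  have hu : resultant π a = (Units.mk0 _ hne : Fˣ) := rfl
  rw [hu, residueChar_apply h Ω _ (Ω.symm α), MulEquiv.apply_symm_apply]
  apply Units.ext
  apply (AdjoinRoot.of π).injective
  have h2 := AdjoinRoot.mk_eq_zero.2 hα
  rw [map_sub, map_pow, sub_eq_zero] at h2
  rw [← AdjoinRoot.mk_C, ← h2, Units.val_pow_eq_pow_val, Units.val_mk0, map_pow,
    resultant_eq_norm hm]
  have h3 := FiniteField.algebraMap_norm_eq_pow (K := F) (x := AdjoinRoot.mk π a)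
  rw [AdjoinRoot.algebraMap_eq] at h3
  rw [h3, ← pow_mul]
  -- the norm is the power with exponent `(q ^ d - 1) / (q - 1)`
  congr 1
  have hcard : Nat.card (AdjoinRoot π) = Fintype.card F ^ π.natDegree := by
    have := Fintype.ofFinite (AdjoinRoot π)
    rw [Nat.card_eq_fintype_card, Module.card_eq_pow_finrank (K := F),
      (AdjoinRoot.powerBasis hπ.ne_zero).finrank, AdjoinRoot.powerBasis_dim]
  rw [hcard, Nat.card_eq_fintype_card, Nat.div_mul_div_comm _ h, mul_comm (Fintype.card F - 1),
    Nat.mul_div_mul_right]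
  · have := Fintype.one_lt_card (α := F); omega
  · simpa using Nat.sub_dvd_pow_sub_pow (Fintype.card F) 1 π.natDegree

lemma residueSymbol_eq_symb (hℓ : 0 < ℓ) (hq : Fintype.card F ≡ 1 [MOD ℓ])
    (h : ℓ ∣ Fintype.card F - 1) (Ω : rootsOfUnity ℓ F ≃* rootsOfUnity ℓ ℂ) (a : F[X]) {c : F[X]}
    (hc : c.Monic) :
    residueSymbol Ω a c = symb (residueChar h Ω) c a := by
  classical
  have hpr : ∀ s : Multiset F[X], (∀ π ∈ s, π.Monic ∧ Irreducible π) →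
      (s.map fun π => primeSymbol Ω a π).prod = symb (residueChar h Ω) s.prod a ∧
        s.prod.Monic := by
    intro s
    induction s using Multiset.induction with
    | empty => intro _; simp [symb_one_left]
    | cons π s ih =>
      intro hs
      obtain ⟨h1, h2⟩ := ih fun p hp => hs p (Multiset.mem_cons_of_mem hp)
      obtain ⟨h3, h4⟩ := hs π (Multiset.mem_cons_self _ _)
      rw [Multiset.map_cons, Multiset.prod_cons, Multiset.prod_cons, symb_mul_left h3 h2, h1,
        primeSymbol_eq_symb hℓ hq h Ω a h3 h4]
      exact ⟨rfl, h3.mul h2⟩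
  have := (hpr (UniqueFactorizationMonoid.normalizedFactors c) fun π hπ => by
    have := (Polynomial.mem_normalizedFactors_iff hc.ne_zero).1 hπ
    exact ⟨this.2.1, this.1⟩).1
  rw [residueSymbol]
  refine this.trans ?_
  congr 1
  have h2 := UniqueFactorizationMonoid.prod_normalizedFactors_eq (a := c) hc.ne_zero
  rw [h2, hc.normalize_eq_self]

end Residue

/-! ### Residue systems in `F[t]` -/

section LowDegree

variable (F : Type*) [Field F] [Fintype F]

lemma finite_degree_lt (r : ℕ) : {f : F[X] | f.degree < r}.Finite := by
  refine Set.Finite.of_injOn (f := fun f : F[X] => fun i : Fin r => f.coeff i)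
    (t := Set.univ) (fun _ _ => Set.mem_univ _) ?_ Set.finite_univ
  intro f hf g hg h
  ext i
  by_cases hi : i < r
  · exact congrFun h ⟨i, hi⟩
  · have hi' : (r : WithBot ℕ) ≤ i := by exact_mod_cast not_lt.1 hi
    rw [coeff_eq_zero_of_degree_lt (lt_of_lt_of_le hf hi'),
      coeff_eq_zero_of_degree_lt (lt_of_lt_of_le hg hi')]

/-- The finite set of polynomials of degree less than `r`. -/
noncomputable def lowDeg (r : ℕ) : Finset F[X] := (finite_degree_lt F r).toFinset

variable {F}

@[simp] lemma mem_lowDeg {r : ℕ} {f : F[X]} : f ∈ lowDeg F r ↔ f.degree < r := by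
  simp [lowDeg]

@[simp] lemma mem_monicDeg {d : ℕ} {f : F[X]} :
    f ∈ monicDeg F d ↔ f.Monic ∧ f.natDegree = d := by
  simp [monicDeg]

@[simp] lemma mem_sqfreeDeg {d : ℕ} {f : F[X]} :
    f ∈ sqfreeDeg F d ↔ (f.Monic ∧ f.natDegree = d) ∧ Squarefree f := by
  simp [sqfreeDeg]

lemma modByMonic_mem_lowDeg {Q : F[X]} (hQ : Q.Monic) (V : F[X]) :
    V %ₘ Q ∈ lowDeg F Q.natDegree := by
  rw [mem_lowDeg, ← degree_eq_natDegree hQ.ne_zero]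
  exact degree_modByMonic_lt _ hQ

lemma eq_of_mem_lowDeg_of_dvd {Q u v : F[X]} (hQ : Q.Monic) (hu : u ∈ lowDeg F Q.natDegree)
    (hv : v ∈ lowDeg F Q.natDegree) (h : Q ∣ u - v) : u = v := by
  rw [← sub_eq_zero]
  refine eq_zero_of_dvd_of_degree_lt h (lt_of_le_of_lt (degree_sub_le _ _) ?_)
  rw [mem_lowDeg] at hu hv
  rw [degree_eq_natDegree hQ.ne_zero]
  exact max_lt hu hv

lemma card_lowDeg (r : ℕ) : (lowDeg F r).card = Fintype.card F ^ r := by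
  have e : {f // f ∈ lowDeg F r} ≃ (Fin r → F) :=
    (Equiv.subtypeEquivRight fun f => by rw [mem_lowDeg, mem_degreeLT]).trans
      (degreeLTEquiv F r).toEquiv
  rw [← Fintype.card_coe, Fintype.card_congr e]
  simp

lemma sum_monicDeg {β : Type*} [AddCommMonoid β] (k : ℕ) (f : F[X] → β) :
    ∑ M ∈ monicDeg F k, f M = ∑ g ∈ lowDeg F k, f (X ^ k + g) := by
  refine Finset.sum_nbij' (fun M => M - X ^ k) (fun g => X ^ k + g) ?_ ?_ ?_ ?_ ?_
  · intro M hM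
    obtain ⟨h1, h2⟩ := mem_monicDeg.1 hM
    rw [mem_lowDeg]
    have h3 : M.degree = k := by rw [degree_eq_natDegree h1.ne_zero, h2]
    rw [← h3]
    exact degree_sub_lt_left (by simp [h3]) h1.ne_zero (by simp [h1.leadingCoeff])
  · intro g hg
    rw [mem_lowDeg] at hg
    rw [mem_monicDeg]
    exact ⟨monic_X_pow_add hg, by rw [natDegree_add_eq_left_of_degree_lt (by simpa using hg)]; simp⟩
  · intro M _; ring
  · intro M _; ring
  · intro M _; congr 1; ring

lemma card_monicDeg (k : ℕ) : (monicDeg F k).card = Fintype.card F ^ k := by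
  rw [Finset.card_eq_sum_ones, sum_monicDeg, ← Finset.card_eq_sum_ones, card_lowDeg]

/-- Multiplication by a unit permutes the residues modulo `Q`. -/
lemma sum_lowDeg_mul {Q w : F[X]} (hQ : Q.Monic) (hw : IsCoprime Q w) (h : F[X] → ℂ)
    (hh : ∀ u v, Q ∣ u - v → h u = h v) :
    ∑ u ∈ lowDeg F Q.natDegree, h (w * u) = ∑ u ∈ lowDeg F Q.natDegree, h u := by
  obtain ⟨a, b, hab⟩ := hw
  have hmod : ∀ V : F[X], Q ∣ V - V %ₘ Q := fun V => by
    have := modByMonic_add_div V Q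
    exact ⟨V /ₘ Q, by rw [sub_eq_iff_eq_add', this]⟩
  refine Finset.sum_nbij' (fun u => (w * u) %ₘ Q) (fun u => (b * u) %ₘ Q)
    (fun u _ => modByMonic_mem_lowDeg hQ _) (fun u _ => modByMonic_mem_lowDeg hQ _) ?_ ?_ ?_
  · intro u hu
    refine eq_of_mem_lowDeg_of_dvd hQ (modByMonic_mem_lowDeg hQ _) hu ?_
    obtain ⟨c, hc⟩ := hmod (b * ((w * u) %ₘ Q))
    obtain ⟨d, hd⟩ := hmod (w * u)
    exact ⟨-c - b * d - a * u, by linear_combination (-1) * hc - b * hd + u * hab⟩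
  · intro u hu
    refine eq_of_mem_lowDeg_of_dvd hQ (modByMonic_mem_lowDeg hQ _) hu ?_
    obtain ⟨c, hc⟩ := hmod (w * ((b * u) %ₘ Q))
    obtain ⟨d, hd⟩ := hmod (b * u)
    exact ⟨-c - w * d - a * u, by linear_combination (-1) * hc - w * hd + u * hab⟩
  · intro u _
    exact hh _ _ (hmod _)

end LowDegree

/-! ### Additive characters modulo a polynomial -/

section AdditiveCharacter

variable {F : Type*} [Field F] (ψ : AddChar F ℂ)

/-- The additive character `V ↦ ψ(res(V / Q))` of `F[t]` modulo `Q`, where the residue of `V / Q` at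
infinity is read off as the coefficient of `t ^ (deg Q - 1)` in the remainder of `V`. For `Q = 1` the
remainder is zero and the character is trivial, so the truncated subtraction is harmless. -/
noncomputable def addCharMod (Q V : F[X]) : ℂ := ψ ((V %ₘ Q).coeff (Q.natDegree - 1))

lemma addCharMod_add (Q V W : F[X]) :
    addCharMod ψ Q (V + W) = addCharMod ψ Q V * addCharMod ψ Q W := by
  rw [addCharMod, add_modByMonic, coeff_add, AddChar.map_add_eq_mul]; rfl

lemma addCharMod_zero (Q : F[X]) : addCharMod ψ Q 0 = 1 := by
  rw [addCharMod, zero_modByMonic, coeff_zero, AddChar.map_zero_eq_one]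

lemma addCharMod_congr {Q V W : F[X]} (hQ : Q.Monic) (h : Q ∣ V - W) :
    addCharMod ψ Q V = addCharMod ψ Q W := by
  rw [addCharMod, modByMonic_eq_of_dvd_sub hQ h]; rfl

lemma addCharMod_of_degree_lt {Q V : F[X]} (hQ : Q.Monic) (h : V.degree < Q.natDegree) :
    addCharMod ψ Q V = ψ (V.coeff (Q.natDegree - 1)) := by
  rw [addCharMod, (modByMonic_eq_self_iff hQ).2]
  rwa [degree_eq_natDegree hQ.ne_zero]

lemma addCharMod_mul_mul {A B : F[X]} (hA : A.Monic) (hB : B.Monic) (V : F[X]) :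
    addCharMod ψ (A * B) (B * V) = addCharMod ψ A V := by
  have h1 : (B * V) %ₘ (A * B) = B * (V %ₘ A) := by
    refine (div_modByMonic_unique (V /ₘ A) _ (hA.mul hB) ⟨?_, ?_⟩).2
    · linear_combination B * modByMonic_add_div V A
    · rw [mul_comm A B, hB.degree_mul_comm, hB.degree_mul_comm, degree_mul, degree_mul,
        add_comm, add_comm A.degree]
      exact WithBot.add_lt_add_left (degree_ne_bot.2 hB.ne_zero) (degree_modByMonic_lt _ hA)
  rw [addCharMod, addCharMod, h1, hA.natDegree_mul hB]
  by_cases ha : A.natDegree = 0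
  · rw [hA.natDegree_eq_zero.1 ha]; simp
  · congr 1
    have : A.natDegree + B.natDegree - 1 = B.natDegree + (A.natDegree - 1) := by omega
    rw [this, coeff_mul_add_eq_of_natDegree_le le_rfl, hB.coeff_natDegree, one_mul]
    have := natDegree_modByMonic_lt V hA (by rintro rfl; simp at ha)
    omega

variable [Finite F]

lemma conj_addCharMod (Q V : F[X]) :
    (starRingEnd ℂ) (addCharMod ψ Q V) = addCharMod ψ Q (-V) := by
  have h := addCharMod_add ψ Q V (-V)
  rw [add_neg_cancel, addCharMod_zero] at h
  have hn : ‖addCharMod ψ Q V‖ = 1 := AddChar.norm_apply ψ _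
  have h0 : addCharMod ψ Q V ≠ 0 := by
    intro h0; rw [h0, norm_zero] at hn; exact zero_ne_one hn
  apply mul_left_cancel₀ h0
  rw [← h, Complex.mul_conj, Complex.normSq_eq_norm_sq, hn]; simp

end AdditiveCharacter

section Orthogonality

variable {F : Type*} [Field F] [Fintype F] {ψ : AddChar F ℂ}

/-- The exponential sum over the monic polynomials of degree `k` is supported on the frequencies of
degree less than `deg Q - k`. The subtraction is truncated: for `k ≥ deg Q` only `V = 0` survives. -/
lemma sum_monicDeg_addCharMod (hψ : ψ ≠ 1) {Q V : F[X]} (hQ : Q.Monic)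
    (hV : V.degree < Q.natDegree) (k : ℕ) :
    ∑ M ∈ monicDeg F k, addCharMod ψ Q (V * M) =
      if V.degree < ((Q.natDegree - k : ℕ) : WithBot ℕ) then
        (Fintype.card F : ℂ) ^ k * ψ (V.coeff (Q.natDegree - k - 1)) else 0 := by
  set r := Q.natDegree with hr
  split_ifs with h
  -- here `V * M` is reduced, and the relevant coefficient involves only the leading one of `M`
  · have : ∀ M ∈ monicDeg F k, addCharMod ψ Q (V * M) = ψ (V.coeff (r - k - 1)) := by
      intro M hM
      obtain ⟨h1, h2⟩ := mem_monicDeg.1 hM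
      by_cases hV0 : V = 0
      · subst hV0; simp [addCharMod_zero]
      have hlt : V.natDegree < r - k := by
        rw [degree_eq_natDegree hV0] at h; exact_mod_cast h
      rw [addCharMod_of_degree_lt ψ hQ]
      · rw [← hr, show r - 1 = (r - k - 1) + k by omega,
          coeff_mul_add_eq_of_natDegree_le (by omega) h2.le, ← h2, h1.coeff_natDegree, mul_one]
      · rw [degree_mul, degree_eq_natDegree hV0, degree_eq_natDegree h1.ne_zero, h2]
        have : V.natDegree + k < Q.natDegree := by omega
        exact_mod_cast this
    rw [Finset.sum_congr rfl this, Finset.sum_const, card_monicDeg]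
    simp
  · have hV0 : V ≠ 0 := by rintro rfl; simp at h
    rw [degree_eq_natDegree hV0] at h hV
    have h' : r - k ≤ V.natDegree := by
      by_contra hc; exact h (by exact_mod_cast not_le.1 hc)
    have hV' : V.natDegree < r := by exact_mod_cast hV
    -- translating `M` by `g`, of degree less than `k`, multiplies the sum by `ψ c ≠ 1`
    obtain ⟨c, hc⟩ := AddChar.ne_one_iff.1 hψ
    set g : F[X] := C (c / V.leadingCoeff) * X ^ (r - 1 - V.natDegree) with hg
    have hlc : V.leadingCoeff ≠ 0 := leadingCoeff_ne_zero.2 hV0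
    have hgd : g.natDegree ≤ r - 1 - V.natDegree := natDegree_C_mul_X_pow_le _ _
    have hgk : g.degree < k := by
      refine lt_of_le_of_lt (degree_C_mul_X_pow_le _ _) ?_
      have : r - 1 - V.natDegree < k := by omega
      exact_mod_cast this
    have he : addCharMod ψ Q (V * g) = ψ c := by
      rw [addCharMod_of_degree_lt ψ hQ]
      · rw [← hr, show r - 1 = V.natDegree + (r - 1 - V.natDegree) by omega,
          coeff_mul_add_eq_of_natDegree_le le_rfl hgd, hg, coeff_C_mul_X_pow, if_pos rfl]
        rw [coeff_natDegree, mul_div_cancel₀ _ hlc]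
      · refine lt_of_le_of_lt degree_le_natDegree ?_
        have : (V * g).natDegree < r :=
          lt_of_le_of_lt natDegree_mul_le (by omega)
        exact_mod_cast this
    have hinv : ∑ M ∈ monicDeg F k, addCharMod ψ Q (V * M) =
        ∑ M ∈ monicDeg F k, addCharMod ψ Q (V * (M + g)) := by
      have hmem : ∀ M ∈ monicDeg F k, ∀ g' : F[X], g'.degree < k → M + g' ∈ monicDeg F k := by
        intro M hM g' hg'
        obtain ⟨h1, h2⟩ := mem_monicDeg.1 hM
        have h3 : M.degree = k := by rw [degree_eq_natDegree h1.ne_zero, h2]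
        rw [mem_monicDeg]
        exact ⟨h1.add_of_left (by rwa [h3]),
          by rw [natDegree_add_eq_left_of_degree_lt (by rwa [h3]), h2]⟩
      refine Finset.sum_nbij' (fun M => M + -g) (fun M => M + g)
        (fun M hM => hmem M hM _ (by rwa [degree_neg])) (fun M hM => hmem M hM _ hgk) ?_ ?_ ?_
      · intro M _; ring
      · intro M _; ring
      · intro M _; congr 2; ring
    have h2 : ∑ M ∈ monicDeg F k, addCharMod ψ Q (V * M) =
        ψ c * ∑ M ∈ monicDeg F k, addCharMod ψ Q (V * M) := by
      conv_lhs => rw [hinv]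
      rw [Finset.mul_sum]
      refine Finset.sum_congr rfl fun M _ => ?_
      rw [mul_add, addCharMod_add, he, mul_comm]
    have h3 : (1 - ψ c) * ∑ M ∈ monicDeg F k, addCharMod ψ Q (V * M) = 0 := by
      rw [sub_mul, one_mul, ← h2, sub_self]
    exact (mul_eq_zero.1 h3).resolve_left (sub_ne_zero.2 (Ne.symm hc))

lemma sum_lowDeg_addCharMod (hψ : ψ ≠ 1) {Q u v : F[X]} (hQ : Q.Monic)
    (hu : u ∈ lowDeg F Q.natDegree) (hv : v ∈ lowDeg F Q.natDegree) [Decidable (u = v)] :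
    ∑ M ∈ lowDeg F Q.natDegree, addCharMod ψ Q ((u - v) * M) =
      if u = v then (Fintype.card F : ℂ) ^ Q.natDegree else 0 := by
  split_ifs with h
  · subst h
    simp [addCharMod_zero, card_lowDeg]
  · have hd : (u - v).degree < Q.natDegree :=
      lt_of_le_of_lt (degree_sub_le _ _) (max_lt (mem_lowDeg.1 hu) (mem_lowDeg.1 hv))
    have h1 := sum_monicDeg_addCharMod hψ hQ hd Q.natDegree
    rw [if_neg (by
      rw [degree_eq_natDegree (sub_ne_zero.2 h), Nat.sub_self]
      intro hc
      have : (u - v).natDegree < 0 := by exact_mod_cast hc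
      omega), sum_monicDeg] at h1
    simp_rw [mul_add, addCharMod_add] at h1
    rw [← Finset.mul_sum] at h1
    refine (mul_eq_zero.1 h1).resolve_left ?_
    have hn : ‖addCharMod ψ Q ((u - v) * X ^ Q.natDegree)‖ = 1 := AddChar.norm_apply ψ _
    intro h0; rw [h0, norm_zero] at hn; exact zero_ne_one hn

end Orthogonality

/-! ### Gauss sums -/

section Gauss

variable {F : Type*} [Field F] [Fintype F] {χ : MulChar F ℂ} {ψ : AddChar F ℂ}

/-- The Gauss sum of the conjugate symbol modulo `A` at frequency `M`. -/
noncomputable def gaussAt (χ : MulChar F ℂ) (ψ : AddChar F ℂ) (A M : F[X]) : ℂ :=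
  ∑ u ∈ lowDeg F A.natDegree, conj (symb χ A u) * addCharMod ψ A (u * M)

/-- The substitution `u ↦ w * u` in a Gauss sum. -/
lemma gaussAt_mul {A : F[X]} (hA : A.Monic) {w : F[X]} (hw : IsCoprime A w) (M : F[X]) :
    gaussAt χ ψ A M = conj (symb χ A w) *
      ∑ u ∈ lowDeg F A.natDegree, conj (symb χ A u) * addCharMod ψ A (w * u * M) := by
  have := sum_lowDeg_mul hA hw (fun u => conj (symb χ A u) * addCharMod ψ A (u * M)) (by
    intro u v huv
    rw [symb_congr hA huv, addCharMod_congr ψ hA (V := u * M) (W := v * M)]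
    rw [← sub_mul]; exact huv.mul_right M)
  rw [gaussAt, ← this, Finset.mul_sum]
  refine Finset.sum_congr rfl fun u _ => ?_
  rw [symb_mul_right hA, map_mul]; ring

/-- A square-free polynomial with a common factor with `M` admits a unit `w` fixing `M` modulo `A`
and having a nontrivial symbol. -/
lemma exists_symb_ne_one_of_not_isCoprime (hχ : χ ≠ 1) {A M : F[X]} (hA : A.Monic)
    (hsq : Squarefree A) (h : ¬ IsCoprime A M) :
    ∃ w, IsCoprime A w ∧ symb χ A w ≠ 1 ∧ A ∣ (w - 1) * M := by
  classical
  have hg : ¬ IsUnit (EuclideanDomain.gcd A M) := by rwa [EuclideanDomain.gcd_isUnit_iff]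
  have hg0 : EuclideanDomain.gcd A M ≠ 0 := by
    intro h0; exact hA.ne_zero (EuclideanDomain.gcd_eq_zero_iff.1 h0).1
  obtain ⟨P, hPm, hPirr, hPd⟩ := exists_monic_irreducible_factor _ hg
  have hPA := hPd.trans (EuclideanDomain.gcd_dvd_left A M)
  obtain ⟨M', hM'⟩ := hPd.trans (EuclideanDomain.gcd_dvd_right A M)
  obtain ⟨A', rfl⟩ := hPA
  have hA' : A'.Monic := hPm.of_mul_monic_left hA
  have hcop : IsCoprime P A' := (squarefree_mul_iff.1 hsq).1.isCoprime
  obtain ⟨u, hu, hu1⟩ := exists_symb_ne_one hχ hPm hPirr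
  obtain ⟨a, b, hab⟩ := hcop
  refine ⟨1 + b * A' * (u - 1), ?_, ?_, ?_⟩
  · refine IsCoprime.mul_left ?_ ?_
    · have : 1 + b * A' * (u - 1) = u + P * (-(a * (u - 1))) := by
        linear_combination (u - 1) * hab
      rw [this]
      exact IsCoprime.add_mul_left_right hu _
    · have : 1 + b * A' * (u - 1) = 1 + A' * (b * (u - 1)) := by ring
      rw [this]
      exact IsCoprime.add_mul_left_right isCoprime_one_right _
  · rw [symb_mul_left hPm hA', symb_congr (M' := u) hPm ⟨-(a * (u - 1)), by
      linear_combination (u - 1) * hab⟩, symb_congr (M' := 1) hA' ⟨b * (u - 1), by ring⟩]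
    have : symb χ A' 1 = 1 := by simp [symb]
    rwa [this, mul_one]
  · rw [hM']
    exact ⟨b * (u - 1) * M', by ring⟩

/-- The symbol modulo a square-free polynomial is primitive, so its Gauss sums at all frequencies,
including those not prime to the modulus, are determined by the one at frequency `1`. -/
lemma gaussAt_eq (hχ : χ ≠ 1) {A : F[X]} (hA : A.Monic) (hsq : Squarefree A) (M : F[X]) :
    gaussAt χ ψ A M = symb χ A M * gaussAt χ ψ A 1 := by
  by_cases h : IsCoprime A M
  · rw [gaussAt_mul hA h 1, ← mul_assoc, symb_mul_conj hA h, one_mul, gaussAt]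
    refine Finset.sum_congr rfl fun u _ => ?_
    congr 2; ring
  · rw [symb_eq_zero hA h, zero_mul]
    obtain ⟨w, hw, hw1, hwd⟩ := exists_symb_ne_one_of_not_isCoprime hχ hA hsq h
    have h1 : gaussAt χ ψ A M = conj (symb χ A w) * gaussAt χ ψ A M := by
      conv_lhs => rw [gaussAt_mul hA hw M]
      rw [gaussAt]
      congr 1
      refine Finset.sum_congr rfl fun u _ => ?_
      rw [addCharMod_congr ψ hA (V := w * u * M) (W := u * M)]
      have : w * u * M - u * M = (w - 1) * M * u := by ring
      rw [this]
      exact hwd.mul_right u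
    have h2 : (1 - conj (symb χ A w)) * gaussAt χ ψ A M = 0 := by
      rw [sub_mul, one_mul, ← h1, sub_self]
    refine (mul_eq_zero.1 h2).resolve_left (sub_ne_zero.2 fun h3 => hw1 ?_)
    have := congrArg conj h3
    simpa using this.symm

/-- Parseval's identity for the Gauss sums. -/
lemma sum_norm_sq_gaussAt (hψ : ψ ≠ 1) {A : F[X]} (hA : A.Monic) :
    ∑ M ∈ lowDeg F A.natDegree, ‖gaussAt χ ψ A M‖ ^ 2 =
      (Fintype.card F : ℝ) ^ A.natDegree * ∑ u ∈ lowDeg F A.natDegree, ‖symb χ A u‖ ^ 2 := by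
  classical
  have key : ∑ M ∈ lowDeg F A.natDegree, gaussAt χ ψ A M * conj (gaussAt χ ψ A M) =
      (Fintype.card F : ℂ) ^ A.natDegree *
        ∑ u ∈ lowDeg F A.natDegree, symb χ A u * conj (symb χ A u) := by
    have h1 : ∀ M, gaussAt χ ψ A M * conj (gaussAt χ ψ A M) =
        ∑ u ∈ lowDeg F A.natDegree, ∑ v ∈ lowDeg F A.natDegree,
          conj (symb χ A u) * symb χ A v * addCharMod ψ A ((u - v) * M) := by
      intro M
      rw [gaussAt, map_sum, Finset.sum_mul_sum]
      refine Finset.sum_congr rfl fun u _ => Finset.sum_congr rfl fun v _ => ?_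
      rw [map_mul, Complex.conj_conj, conj_addCharMod, sub_mul, sub_eq_add_neg, addCharMod_add]
      ring
    simp_rw [h1]
    rw [Finset.sum_comm]
    rw [Finset.mul_sum]
    refine Finset.sum_congr rfl fun u hu => ?_
    rw [Finset.sum_comm]
    have h2 : ∀ v ∈ lowDeg F A.natDegree, ∑ M ∈ lowDeg F A.natDegree,
        conj (symb χ A u) * symb χ A v * addCharMod ψ A ((u - v) * M) =
        if u = v then (Fintype.card F : ℂ) ^ A.natDegree * (symb χ A v * conj (symb χ A u))
          else 0 := by
      intro v hv
      rw [← Finset.mul_sum, sum_lowDeg_addCharMod hψ hA hu hv]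
      split_ifs
      · ring
      · ring
    rw [Finset.sum_congr rfl h2, Finset.sum_ite_eq, if_pos hu]
  simp_rw [Complex.mul_conj, Complex.normSq_eq_norm_sq] at key
  exact_mod_cast key

/-- The symbol modulo a square-free polynomial is a multiple of the Fourier transform of its
conjugate, with a constant of absolute value `|A| ^ (-1/2)`. -/
lemma exists_gauss (hχ : χ ≠ 1) (hψ : ψ ≠ 1) {A : F[X]} (hA : A.Monic) (hsq : Squarefree A) :
    ∃ c : ℂ, ‖c‖ ^ 2 = ((Fintype.card F : ℝ) ^ A.natDegree)⁻¹ ∧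
      ∀ M, symb χ A M =
        c * ∑ u ∈ lowDeg F A.natDegree, conj (symb χ A u) * addCharMod ψ A (u * M) := by
  have h1 := sum_norm_sq_gaussAt (χ := χ) hψ hA
  rw [Finset.sum_congr rfl fun M _ => show ‖gaussAt χ ψ A M‖ ^ 2 =
    ‖symb χ A M‖ ^ 2 * ‖gaussAt χ ψ A 1‖ ^ 2 by
      rw [gaussAt_eq hχ hA hsq M, norm_mul, mul_pow], ← Finset.sum_mul, mul_comm] at h1
  have hpos : 0 < ∑ u ∈ lowDeg F A.natDegree, ‖symb χ A u‖ ^ 2 := by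
    refine Finset.sum_pos' (fun _ _ => by positivity) ⟨1 %ₘ A, modByMonic_mem_lowDeg hA _, ?_⟩
    have : symb χ A (1 %ₘ A) = 1 := by
      rw [symb_congr (M' := 1) hA ⟨-(1 /ₘ A), by linear_combination modByMonic_add_div 1 A⟩]
      simp [symb]
    rw [this]; simp
  have h2 : ‖gaussAt χ ψ A 1‖ ^ 2 = (Fintype.card F : ℝ) ^ A.natDegree :=
    mul_right_cancel₀ hpos.ne' h1
  have hq : (0 : ℝ) < (Fintype.card F : ℝ) ^ A.natDegree := by
    have : (0 : ℝ) < Fintype.card F := by exact_mod_cast Fintype.card_pos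
    positivity
  have h0 : gaussAt χ ψ A 1 ≠ 0 := by
    intro h0; rw [h0] at h2; simp at h2; linarith
  refine ⟨(gaussAt χ ψ A 1)⁻¹, by rw [norm_inv, inv_pow, h2], fun M => ?_⟩
  have := gaussAt_eq (ψ := ψ) hχ hA hsq M
  rw [show ∑ u ∈ lowDeg F A.natDegree, conj (symb χ A u) * addCharMod ψ A (u * M) =
    gaussAt χ ψ A M from rfl, this]
  field_simp

end Gauss

/-! ### Poisson summation -/

section Poisson

variable {F : Type*} [Field F] [Fintype F] {χ : MulChar F ℂ} {ψ : AddChar F ℂ}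

/-- For coprime monic `A`, `B` every polynomial of degree less than `deg A + deg B` is uniquely
`u * B - v * A` with `deg u < deg A` and `deg v < deg B`. -/
lemma sum_lowDeg_crt {A B : F[X]} (hA : A.Monic) (hB : B.Monic) (hAB : IsCoprime A B)
    (h : F[X] → ℂ) :
    ∑ u ∈ lowDeg F A.natDegree, ∑ v ∈ lowDeg F B.natDegree, h (u * B - v * A) =
      ∑ V ∈ lowDeg F (A.natDegree + B.natDegree), h V := by
  rw [← Finset.sum_product']
  have hdeg : ∀ (P Q w : F[X]), P.Monic → Q.Monic → w.degree < P.natDegree →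
      (w * Q).degree < ((P.natDegree + Q.natDegree : ℕ) : WithBot ℕ) := by
    intro P Q w _ hQ hw
    rw [hQ.degree_mul, degree_eq_natDegree hQ.ne_zero, Nat.cast_add]
    exact WithBot.add_lt_add_right (by simp) hw
  have hmem : ∀ p ∈ lowDeg F A.natDegree ×ˢ lowDeg F B.natDegree,
      p.1 * B - p.2 * A ∈ lowDeg F (A.natDegree + B.natDegree) := by
    intro p hp
    rw [Finset.mem_product, mem_lowDeg, mem_lowDeg] at hp
    rw [mem_lowDeg]
    refine lt_of_le_of_lt (degree_sub_le _ _) (max_lt (hdeg _ _ _ hA hB hp.1) ?_)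
    rw [add_comm]
    exact hdeg _ _ _ hB hA hp.2
  have hinj : ∀ p ∈ lowDeg F A.natDegree ×ˢ lowDeg F B.natDegree,
      ∀ p' ∈ lowDeg F A.natDegree ×ˢ lowDeg F B.natDegree,
      p.1 * B - p.2 * A = p'.1 * B - p'.2 * A → p = p' := by
    intro p hp p' hp' h
    rw [Finset.mem_product] at hp hp'
    have h1 : A ∣ (p.1 - p'.1) * B := ⟨p.2 - p'.2, by linear_combination h⟩
    have h2 : B ∣ (p.2 - p'.2) * A := ⟨p.1 - p'.1, by linear_combination -h⟩
    exact Prod.ext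
      (eq_of_mem_lowDeg_of_dvd hA hp.1 hp'.1 (hAB.dvd_of_dvd_mul_right h1))
      (eq_of_mem_lowDeg_of_dvd hB hp.2 hp'.2 (hAB.symm.dvd_of_dvd_mul_right h2))
  refine Finset.sum_bij (fun p _ => p.1 * B - p.2 * A) hmem
    (fun p hp p' hp' => hinj p hp p' hp') ?_ fun _ _ => rfl
  intro V hV
  obtain ⟨p, hp, rfl⟩ := Finset.surj_on_of_inj_on_of_card_le
    (s := lowDeg F A.natDegree ×ˢ lowDeg F B.natDegree)
    (t := lowDeg F (A.natDegree + B.natDegree)) (fun p _ => p.1 * B - p.2 * A) hmem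
    (fun p p' hp hp' => hinj p hp p' hp')
    (by rw [Finset.card_product, card_lowDeg, card_lowDeg, card_lowDeg, pow_add]) V hV
  exact ⟨p, hp, rfl⟩

/-- Poisson summation for the character `χ_A · conj χ_B`: reciprocity cancels the two symbols
between `A` and `B`, so that `A` and `B` are separated in the dual sum. For `k ≥ deg A + deg B` the
dual sum is reduced to `V = 0`. -/
lemma sum_monicDeg_symb_mul_conj (hψ : ψ ≠ 1) (hneg : χ (-1) = 1) {A B : F[X]} (hA : A.Monic)
    (hB : B.Monic) (hAB : IsCoprime A B) {c c' : ℂ}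
    (hc : ∀ M, symb χ A M =
        c * ∑ u ∈ lowDeg F A.natDegree, conj (symb χ A u) * addCharMod ψ A (u * M))
    (hc' : ∀ M, symb χ B M =
        c' * ∑ u ∈ lowDeg F B.natDegree, conj (symb χ B u) * addCharMod ψ B (u * M)) (k : ℕ) :
    ∑ M ∈ monicDeg F k, symb χ A M * conj (symb χ B M) =
      (Fintype.card F : ℂ) ^ k * (c * conj c' * conj (symb χ B (-1))) *
        ∑ V ∈ lowDeg F (A.natDegree + B.natDegree - k),
          ψ (V.coeff (A.natDegree + B.natDegree - k - 1)) *
            (conj (symb χ A V) * symb χ B V) := by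
  classical
  set a := A.natDegree with ha
  set b := B.natDegree with hb
  set s : ℂ := conj (symb χ B (-1)) with hs
  have hsB : IsCoprime B (-1) := isCoprime_one_right.neg_right
  have hs1 : s * symb χ B (-1) = 1 := by rw [hs, mul_comm]; exact symb_mul_conj hB hsB
  have hrec : symb χ B A * conj (symb χ A B) = 1 := by
    rw [symb_comm hneg B A]; exact symb_mul_conj hA hAB
  have hprod : ∀ M, symb χ A M * conj (symb χ B M) = c * conj c' * s *
      ∑ V ∈ lowDeg F (a + b), conj (symb χ A V) * symb χ B V * addCharMod ψ (A * B) (V * M) := by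
    intro M
    rw [← sum_lowDeg_crt hA hB hAB
      fun V => conj (symb χ A V) * symb χ B V * addCharMod ψ (A * B) (V * M), hc M, hc' M, map_mul,
      map_sum, mul_mul_mul_comm, Finset.sum_mul_sum, mul_assoc _ s]
    congr 1
    rw [Finset.mul_sum]
    refine Finset.sum_congr rfl fun u _ => ?_
    rw [Finset.mul_sum]
    refine Finset.sum_congr rfl fun v _ => ?_
    -- the frequency of the product is `V = u * B - v * A`
    have h1 : symb χ A (u * B - v * A) = symb χ A u * symb χ A B := by
      rw [symb_congr (M' := u * B) hA ⟨-v, by ring⟩, symb_mul_right hA]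
    have h2 : symb χ B (u * B - v * A) = symb χ B (-1) * symb χ B v * symb χ B A := by
      rw [symb_congr (M' := (-1) * v * A) hB ⟨u, by ring⟩, symb_mul_right hB, symb_mul_right hB]
    have h3 : addCharMod ψ (A * B) ((u * B - v * A) * M) =
        addCharMod ψ A (u * M) * addCharMod ψ B (-(v * M)) := by
      rw [show (u * B - v * A) * M = B * (u * M) + A * (-(v * M)) by ring, addCharMod_add,
        addCharMod_mul_mul ψ hA hB, mul_comm A B, addCharMod_mul_mul ψ hB hA]
    rw [h1, h2, h3, map_mul, map_mul, Complex.conj_conj, conj_addCharMod]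
    linear_combination (-(conj (symb χ A u) * addCharMod ψ A (u * M) * symb χ B v *
      addCharMod ψ B (-(v * M)))) * (symb χ B A * conj (symb χ A B) * hs1 + hrec)
  simp_rw [hprod]
  rw [← Finset.mul_sum, Finset.sum_comm]
  have hdeg : (A * B).natDegree = a + b := hA.natDegree_mul hB
  have hE : ∀ V ∈ lowDeg F (a + b),
      ∑ M ∈ monicDeg F k, conj (symb χ A V) * symb χ B V * addCharMod ψ (A * B) (V * M) =
      if V ∈ lowDeg F (a + b - k) then (Fintype.card F : ℂ) ^ k *
        (ψ (V.coeff (a + b - k - 1)) * (conj (symb χ A V) * symb χ B V)) else 0 := by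
    intro V hV
    rw [← Finset.mul_sum, sum_monicDeg_addCharMod hψ (hA.mul hB) (by rwa [hdeg, ← mem_lowDeg]),
      hdeg]
    simp only [mem_lowDeg]
    split_ifs <;> ring
  rw [Finset.sum_congr rfl hE, ← Finset.sum_filter]
  have hf : (lowDeg F (a + b)).filter (fun V => V ∈ lowDeg F (a + b - k)) =
      lowDeg F (a + b - k) := by
    ext V
    rw [Finset.mem_filter, mem_lowDeg, mem_lowDeg, and_iff_right_iff_imp]
    intro h
    exact lt_of_lt_of_le h (by exact_mod_cast Nat.sub_le _ _)
  rw [hf, ← Finset.mul_sum]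
  ring

end Poisson

/-! ### Möbius inversion and greatest common divisors -/

lemma mul_divByMonic_of_dvd {R : Type*} [CommRing R] {P f : R[X]} (hP : P.Monic) (h : P ∣ f) :
    P * (f /ₘ P) = f := by
  obtain ⟨g, rfl⟩ := h
  rw [mul_divByMonic_cancel_left _ hP]

section Divisors

variable {F : Type*} [Field F]

open scoped Classical in
/-- The monic greatest common divisor. -/
noncomputable def mgcd (A B : F[X]) : F[X] := normalize (EuclideanDomain.gcd A B)

lemma mgcd_dvd_left (A B : F[X]) : mgcd A B ∣ A := by
  classical exact normalize_dvd_iff.2 (EuclideanDomain.gcd_dvd_left A B)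

lemma mgcd_dvd_right (A B : F[X]) : mgcd A B ∣ B := by
  classical exact normalize_dvd_iff.2 (EuclideanDomain.gcd_dvd_right A B)

lemma dvd_mgcd {A B C : F[X]} (h₁ : C ∣ A) (h₂ : C ∣ B) : C ∣ mgcd A B := by
  classical exact dvd_normalize_iff.2 (EuclideanDomain.dvd_gcd h₁ h₂)

lemma monic_mgcd {A : F[X]} (hA : A ≠ 0) (B : F[X]) : (mgcd A B).Monic := by
  classical
  exact monic_normalize fun h => hA (EuclideanDomain.gcd_eq_zero_iff.1 h).1

lemma mgcd_eq_one_iff {A B : F[X]} : mgcd A B = 1 ↔ IsCoprime A B := by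
  classical
  rw [mgcd, normalize_eq_one, EuclideanDomain.gcd_isUnit_iff]

open scoped Classical in
/-- The Liouville function, which is the Möbius function on square-free polynomials; it is used only
for these. -/
noncomputable def moebius (f : F[X]) : ℂ :=
  (-1) ^ Multiset.card (UniqueFactorizationMonoid.normalizedFactors f)

lemma norm_moebius (f : F[X]) : ‖moebius f‖ = 1 := by simp [moebius]

lemma moebius_mul_irreducible {P f : F[X]} (hP : Irreducible P) (hf : f ≠ 0) :
    moebius (P * f) = -moebius f := by
  classical
  rw [moebius, moebius, UniqueFactorizationMonoid.normalizedFactors_mul hP.ne_zero hf,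
    UniqueFactorizationMonoid.normalizedFactors_irreducible hP, Multiset.card_add,
    Multiset.card_singleton, pow_add, pow_one, neg_one_mul]

variable [Fintype F]

open scoped Classical in
/-- The monic square-free polynomials of degree at most `n`. -/
noncomputable def sqfreeLE (F : Type*) [Field F] [Fintype F] (n : ℕ) : Finset F[X] :=
  (Finset.range (n + 1)).biUnion (sqfreeDeg F)

@[simp] lemma mem_sqfreeLE {n : ℕ} {f : F[X]} :
    f ∈ sqfreeLE F n ↔ f.Monic ∧ f.natDegree ≤ n ∧ Squarefree f := by
  simp only [sqfreeLE, Finset.mem_biUnion, Finset.mem_range, mem_sqfreeDeg]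
  constructor
  · rintro ⟨d, hd, ⟨h1, h2⟩, h3⟩
    exact ⟨h1, by omega, h3⟩
  · rintro ⟨h1, h2, h3⟩
    exact ⟨_, by omega, ⟨h1, rfl⟩, h3⟩

open scoped Classical in
/-- Möbius inversion: the Möbius function sums to zero over the divisors of `D ≠ 1`. -/
lemma sum_moebius {n : ℕ} {D : F[X]} (hD : D ∈ sqfreeLE F n) :
    ∑ f ∈ (sqfreeLE F n).filter (· ∣ D), moebius f = if D = 1 then 1 else 0 := by
  obtain ⟨hm, hn, hs⟩ := mem_sqfreeLE.1 hD
  split_ifs with h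
  · subst h
    have : (sqfreeLE F n).filter (· ∣ (1 : F[X])) = {1} := by
      ext f
      simp only [Finset.mem_filter, mem_sqfreeLE, Finset.mem_singleton]
      constructor
      · rintro ⟨⟨h1, -, -⟩, h2⟩
        exact h1.eq_one_of_isUnit (isUnit_of_dvd_one h2)
      · rintro rfl
        exact ⟨⟨monic_one, by simp, squarefree_one⟩, dvd_rfl⟩
    rw [this, Finset.sum_singleton, moebius, UniqueFactorizationMonoid.normalizedFactors_one]
    simp
  · have hu : ¬ IsUnit D := fun hu => h (hm.eq_one_of_isUnit hu)
    obtain ⟨P, hPm, hP, hPD⟩ := exists_monic_irreducible_factor D hu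
    have hpos := hP.natDegree_pos
    have hmemPf : ∀ f ∈ (sqfreeLE F n).filter (· ∣ D), ¬ P ∣ f →
        P * f ∈ (sqfreeLE F n).filter (· ∣ D) := by
      intro f hf hPf
      rw [Finset.mem_filter, mem_sqfreeLE] at hf ⊢
      have hc : IsCoprime P f := hP.coprime_iff_not_dvd.2 hPf
      have hd : P * f ∣ D := hc.mul_dvd hPD hf.2
      exact ⟨⟨hPm.mul hf.1.1, (natDegree_le_of_dvd hd hm.ne_zero).trans hn,
        hs.squarefree_of_dvd hd⟩, hd⟩
    have hdiv : ∀ f ∈ (sqfreeLE F n).filter (· ∣ D), P ∣ f →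
        f /ₘ P ∈ (sqfreeLE F n).filter (· ∣ D) ∧ P * (f /ₘ P) = f ∧ ¬ P ∣ f /ₘ P := by
      intro f hf hPf
      rw [Finset.mem_filter, mem_sqfreeLE] at hf
      have he : P * (f /ₘ P) = f := (mul_divByMonic_of_dvd hPm hPf)
      have hd : f /ₘ P ∣ f := ⟨P, by rw [mul_comm]; exact he.symm⟩
      have hsf := hf.1.2.2
      refine ⟨?_, he, ?_⟩
      · rw [Finset.mem_filter, mem_sqfreeLE]
        refine ⟨⟨hPm.of_mul_monic_left (by rw [he]; exact hf.1.1),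
          (natDegree_le_of_dvd hd hf.1.1.ne_zero).trans hf.1.2.1,
          hsf.squarefree_of_dvd hd⟩, hd.trans hf.2⟩
      · rintro ⟨g, hg⟩
        rw [← he, hg, ← mul_assoc] at hsf
        exact hP.not_isUnit (hsf P (dvd_mul_right _ _))
    -- multiplying or dividing by the prime `P` of `D` pairs divisors of opposite sign
    refine Finset.sum_involution (fun f _ => if P ∣ f then f /ₘ P else P * f) ?_ ?_ ?_ ?_
    · intro f hf
      have hf0 : f ≠ 0 := (mem_sqfreeLE.1 (Finset.mem_filter.1 hf).1).1.ne_zero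
      split_ifs with hPf
      · obtain ⟨h1, h2, -⟩ := hdiv f hf hPf
        have hg0 : f /ₘ P ≠ 0 := (mem_sqfreeLE.1 (Finset.mem_filter.1 h1).1).1.ne_zero
        conv_lhs => rw [← h2]
        rw [h2]
        nth_rewrite 1 [← h2]
        rw [moebius_mul_irreducible hP hg0, neg_add_cancel]
      · rw [moebius_mul_irreducible hP hf0, add_neg_cancel]
    · intro f hf _ hfix
      split_ifs at hfix with hPf
      · exact (hdiv f hf hPf).2.2 (by rw [hfix]; exact hPf)
      · exact hPf ⟨f, hfix.symm⟩
    · intro f hf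
      split_ifs with hPf
      · exact (hdiv f hf hPf).1
      · exact hmemPf f hf hPf
    · intro f hf
      split_ifs with hPf h2 h2
      · exact absurd h2 (hdiv f hf hPf).2.2
      · exact (hdiv f hf hPf).2.1
      · exact mul_divByMonic_cancel_left f hPm
      · exact absurd (dvd_mul_right _ _) h2

open scoped Classical in
/-- Detection of coprimality by the Möbius function. -/
lemma sum_moebius_dvd_dvd {n : ℕ} {D : F[X]} (hD : D ∈ sqfreeLE F n) (M : F[X]) :
    ∑ f ∈ sqfreeLE F n, (if f ∣ D ∧ f ∣ M then moebius f else 0) =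
      if IsCoprime D M then 1 else 0 := by
  obtain ⟨hm, hn, hs⟩ := mem_sqfreeLE.1 hD
  have hG : mgcd D M ∈ sqfreeLE F n := mem_sqfreeLE.2 ⟨monic_mgcd hm.ne_zero M,
    (natDegree_le_of_dvd (mgcd_dvd_left D M) hm.ne_zero).trans hn,
    hs.squarefree_of_dvd (mgcd_dvd_left D M)⟩
  rw [← Finset.sum_filter]
  have : (sqfreeLE F n).filter (fun f => f ∣ D ∧ f ∣ M) =
      (sqfreeLE F n).filter (· ∣ mgcd D M) := by
    refine Finset.filter_congr fun f _ => ⟨fun h => dvd_mgcd h.1 h.2, fun h =>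
      ⟨h.trans (mgcd_dvd_left D M), h.trans (mgcd_dvd_right D M)⟩⟩
  rw [this, sum_moebius hG]
  simp only [mgcd_eq_one_iff]

open scoped Classical in
/-- Pairs of square-free polynomials sorted by their greatest common divisor. -/
lemma sum_sqfreeDeg_pairs (n : ℕ) (G : F[X] → F[X] → ℂ)
    (hG : ∀ N₁ N₂, ¬ (N₁ ∈ sqfreeDeg F n ∧ N₂ ∈ sqfreeDeg F n) → G N₁ N₂ = 0) :
    ∑ N₁ ∈ sqfreeDeg F n, ∑ N₂ ∈ sqfreeDeg F n, G N₁ N₂ =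
      ∑ D ∈ sqfreeLE F n, ∑ A ∈ sqfreeDeg F (n - D.natDegree), ∑ B ∈ sqfreeDeg F (n - D.natDegree),
        if IsCoprime A B then G (D * A) (D * B) else 0 := by
  rw [← Finset.sum_product']
  rw [← Finset.sum_fiberwise_of_maps_to (t := sqfreeLE F n) (g := fun p => mgcd p.1 p.2)]
  · refine Finset.sum_congr rfl fun D hD => ?_
    obtain ⟨hDm, hDn, hDs⟩ := mem_sqfreeLE.1 hD
    rw [← Finset.sum_product', ← Finset.sum_filter]
    symm
    have hsub : ∀ p ∈ ((sqfreeDeg F (n - D.natDegree) ×ˢ sqfreeDeg F (n - D.natDegree)).filter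
        fun p => IsCoprime p.1 p.2),
        p ∉ ((sqfreeDeg F (n - D.natDegree) ×ˢ sqfreeDeg F (n - D.natDegree)).filter
        fun p => IsCoprime p.1 p.2 ∧ D * p.1 ∈ sqfreeDeg F n ∧ D * p.2 ∈ sqfreeDeg F n) →
        G (D * p.1) (D * p.2) = 0 := by
      intro p hp hp'
      apply hG
      intro h
      rw [Finset.mem_filter] at hp hp'
      exact hp' ⟨hp.1, hp.2, h⟩
    rw [← Finset.sum_subset _ hsub]
    · refine Finset.sum_nbij' (fun p => (D * p.1, D * p.2)) (fun p => (p.1 /ₘ D, p.2 /ₘ D))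
        ?_ ?_ ?_ ?_ ?_
      · intro p hp
        rw [Finset.mem_filter] at hp
        rw [Finset.mem_filter, Finset.mem_product]
        refine ⟨hp.2.2, ?_⟩
        have hne : D * p.1 ≠ 0 := (mem_sqfreeDeg.1 hp.2.2.1).1.1.ne_zero
        refine eq_of_monic_of_associated (monic_mgcd hne _) hDm (associated_of_dvd_dvd ?_ ?_)
        · obtain ⟨a, b, hab⟩ := hp.2.1
          have h1 := mgcd_dvd_left (D * p.1) (D * p.2)
          have h2 := mgcd_dvd_right (D * p.1) (D * p.2)
          have : D = a * (D * p.1) + b * (D * p.2) := by linear_combination (-D) * hab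
          calc mgcd (D * p.1) (D * p.2) ∣ a * (D * p.1) + b * (D * p.2) :=
                dvd_add (h1.mul_left a) (h2.mul_left b)
            _ = D := this.symm
        · exact dvd_mgcd (dvd_mul_right _ _) (dvd_mul_right _ _)
      · intro p hp
        rw [Finset.mem_filter, Finset.mem_product] at hp
        obtain ⟨⟨h1, h2⟩, h3⟩ := hp
        have hd1 : D * (p.1 /ₘ D) = p.1 :=
          mul_divByMonic_of_dvd hDm (h3 ▸ mgcd_dvd_left _ _)
        have hd2 : D * (p.2 /ₘ D) = p.2 :=
          mul_divByMonic_of_dvd hDm (h3 ▸ mgcd_dvd_right _ _)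
        have hq : ∀ N ∈ sqfreeDeg F n, D * (N /ₘ D) = N →
            N /ₘ D ∈ sqfreeDeg F (n - D.natDegree) := by
          intro N hN he
          rw [mem_sqfreeDeg] at hN ⊢
          have hm : (N /ₘ D).Monic := hDm.of_mul_monic_left (by rw [he]; exact hN.1.1)
          refine ⟨⟨hm, ?_⟩, hN.2.squarefree_of_dvd ⟨D, by rw [mul_comm]; exact he.symm⟩⟩
          have := hDm.natDegree_mul hm
          rw [he, hN.1.2] at this
          omega
        rw [Finset.mem_filter, Finset.mem_product]
        refine ⟨⟨hq _ h1 hd1, hq _ h2 hd2⟩, ?_, ?_, ?_⟩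
        · rw [← mgcd_eq_one_iff]
          have hne : p.1 /ₘ D ≠ 0 := (mem_sqfreeDeg.1 (hq _ h1 hd1)).1.1.ne_zero
          refine (monic_mgcd hne _).eq_one_of_isUnit ?_
          have : D * mgcd (p.1 /ₘ D) (p.2 /ₘ D) ∣ mgcd p.1 p.2 := by
            refine dvd_mgcd ?_ ?_
            · conv_rhs => rw [← hd1]
              exact mul_dvd_mul_left _ (mgcd_dvd_left _ _)
            · conv_rhs => rw [← hd2]
              exact mul_dvd_mul_left _ (mgcd_dvd_right _ _)
          rw [h3] at this
          exact isUnit_of_dvd_one ((mul_dvd_mul_iff_left hDm.ne_zero).1 (by rwa [mul_one]))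
        · rwa [hd1]
        · rwa [hd2]
      · intro p _
        exact Prod.ext (mul_divByMonic_cancel_left _ hDm) (mul_divByMonic_cancel_left _ hDm)
      · intro p hp
        rw [Finset.mem_filter, Finset.mem_product] at hp
        obtain ⟨⟨h1, h2⟩, h3⟩ := hp
        exact Prod.ext (mul_divByMonic_of_dvd hDm (h3 ▸ mgcd_dvd_left _ _))
          (mul_divByMonic_of_dvd hDm (h3 ▸ mgcd_dvd_right _ _))
      · intro p _; rfl
    · intro p hp
      rw [Finset.mem_filter] at hp ⊢
      exact ⟨hp.1, hp.2.1⟩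
  · intro p hp
    rw [Finset.mem_product, mem_sqfreeDeg, mem_sqfreeDeg] at hp
    have hne := hp.1.1.1.ne_zero
    exact mem_sqfreeLE.2 ⟨monic_mgcd hne _,
      (natDegree_le_of_dvd (mgcd_dvd_left _ _) hne).trans hp.1.1.2.le,
      hp.1.2.squarefree_of_dvd (mgcd_dvd_left _ _)⟩

end Divisors

/-! ### The divisor bound -/

section DivisorBound

variable {F : Type*} [Field F] [Fintype F]

open scoped Classical in
lemma card_divisors_le {n : ℕ} {D : F[X]} (hD : D ∈ sqfreeLE F n) :
    ((sqfreeLE F n).filter (· ∣ D)).card ≤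
      2 ^ (UniqueFactorizationMonoid.normalizedFactors D).toFinset.card := by
  obtain ⟨hm, hn, hs⟩ := mem_sqfreeLE.1 hD
  rw [← Finset.card_powerset]
  refine Finset.card_le_card_of_injOn
    (fun f => (UniqueFactorizationMonoid.normalizedFactors f).toFinset) ?_ ?_
  · intro f hf
    rw [Finset.mem_coe, Finset.mem_filter] at hf
    rw [Finset.mem_coe, Finset.mem_powerset, Multiset.toFinset_subset]
    exact Multiset.subset_of_le
      ((UniqueFactorizationMonoid.dvd_iff_normalizedFactors_le_normalizedFactors
        (mem_sqfreeLE.1 hf.1).1.ne_zero hm.ne_zero).1 hf.2)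
  · have hprod : ∀ f ∈ (sqfreeLE F n).filter (· ∣ D),
        (UniqueFactorizationMonoid.normalizedFactors f).toFinset.val.prod = f := by
      intro f hf
      obtain ⟨h1, -, h3⟩ := mem_sqfreeLE.1 (Finset.mem_filter.1 hf).1
      rw [Multiset.toFinset_val, Multiset.dedup_eq_self.2
        ((UniqueFactorizationMonoid.squarefree_iff_nodup_normalizedFactors h1.ne_zero).1 h3),
        UniqueFactorizationMonoid.prod_normalizedFactors_eq h1.ne_zero, h1.normalize_eq_self]
    intro f hf g hg h
    rw [Finset.mem_coe] at hf hg
    rw [← hprod f hf, ← hprod g hg]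
    exact congrArg (fun s : Finset F[X] => s.val.prod) h

open scoped Classical in
/-- The divisor bound: a square-free polynomial of degree at most `n` has `O(q ^ (δ n))` monic
divisors. -/
lemma exists_divisor_bound (F : Type*) [Field F] [Fintype F] {δ : ℝ} (hδ : 0 < δ) :
    ∃ C : ℝ, 1 ≤ C ∧ ∀ (n : ℕ) (D : F[X]), D ∈ sqfreeLE F n →
      (((sqfreeLE F n).filter (· ∣ D)).card : ℝ) ≤ C * (Fintype.card F : ℝ) ^ (δ * n) := by
  set q := Fintype.card F with hq
  have hq1 : (1 : ℝ) < q := by exact_mod_cast Fintype.one_lt_card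
  have hq2 : (2 : ℝ) ≤ q := by exact_mod_cast Fintype.one_lt_card
  obtain ⟨k, hk⟩ := exists_nat_ge (1 / δ)
  have hkδ : 1 ≤ δ * k := by rwa [div_le_iff₀' hδ] at hk
  have h2 : (2 : ℝ) ≤ (q : ℝ) ^ (δ * k) := by
    calc (2 : ℝ) ≤ q := hq2
      _ = (q : ℝ) ^ (1 : ℝ) := (Real.rpow_one _).symm
      _ ≤ _ := Real.rpow_le_rpow_of_exponent_le hq1.le hkδ
  refine ⟨2 ^ (q ^ k), one_le_pow₀ (by norm_num), fun n D hD => ?_⟩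
  obtain ⟨hm, hn, hs⟩ := mem_sqfreeLE.1 hD
  set w := (UniqueFactorizationMonoid.normalizedFactors D).toFinset with hw
  have hmem : ∀ P ∈ w, Irreducible P ∧ P.Monic := by
    intro P hP
    have := (Polynomial.mem_normalizedFactors_iff hm.ne_zero).1 (Multiset.mem_toFinset.1 hP)
    exact ⟨this.1, this.2.1⟩
  have hdeg : ∑ P ∈ w, P.natDegree ≤ n := by
    rw [← natDegree_prod_of_monic _ _ fun P hP => (hmem P hP).2]
    refine le_trans (natDegree_le_of_dvd ?_ hm.ne_zero) hn
    have h1 : ∏ P ∈ w, P = D := by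
      rw [Finset.prod_eq_multiset_prod, Multiset.map_id', hw, Multiset.toFinset_val,
        Multiset.dedup_eq_self.2
        ((UniqueFactorizationMonoid.squarefree_iff_nodup_normalizedFactors hm.ne_zero).1 hs),
        UniqueFactorizationMonoid.prod_normalizedFactors_eq hm.ne_zero, hm.normalize_eq_self]
    exact h1.dvd
  -- there are boundedly many primes of degree less than `k`, and each of the others has `q ^ (δ k) ≥ 2`
  -- and uses up at least `k` of the degree of `D`
  set s := w.filter fun P => P.natDegree < k
  set b := w.filter fun P => ¬ P.natDegree < k
  have hsb : s.card + b.card = w.card := Finset.card_filter_add_card_filter_not _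
  have hsc : s.card ≤ q ^ k := by
    rw [hq, ← card_lowDeg (F := F) k]
    refine Finset.card_le_card fun P hP => ?_
    obtain ⟨h1, h2⟩ := Finset.mem_filter.1 hP
    rw [mem_lowDeg, degree_eq_natDegree (hmem P h1).1.ne_zero]
    exact_mod_cast h2
  have hbc : b.card * k ≤ n := by
    refine le_trans ?_ hdeg
    calc b.card * k = ∑ P ∈ b, k := by simp
      _ ≤ ∑ P ∈ b, P.natDegree :=
        Finset.sum_le_sum fun P hP => not_lt.1 (Finset.mem_filter.1 hP).2
      _ ≤ _ := Finset.sum_le_sum_of_subset (Finset.filter_subset _ _)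
  calc (((sqfreeLE F n).filter (· ∣ D)).card : ℝ) ≤ 2 ^ w.card := by
        exact_mod_cast card_divisors_le hD
    _ = 2 ^ s.card * 2 ^ b.card := by rw [← hsb, pow_add]
    _ ≤ 2 ^ (q ^ k) * ((q : ℝ) ^ (δ * k)) ^ b.card := by
        refine mul_le_mul (pow_le_pow_right₀ (by norm_num) hsc)
          (pow_le_pow_left₀ (by norm_num) h2 _) (by positivity) (by positivity)
    _ ≤ 2 ^ (q ^ k) * (q : ℝ) ^ (δ * n) := by
        refine mul_le_mul_of_nonneg_left ?_ (by positivity)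
        rw [← Real.rpow_natCast, ← Real.rpow_mul (by positivity)]
        refine Real.rpow_le_rpow_of_exponent_le hq1.le ?_
        rw [mul_assoc]
        refine mul_le_mul_of_nonneg_left ?_ hδ.le
        rw [mul_comm]
        exact_mod_cast hbc

end DivisorBound

/-! ### Large sieve constants and duality -/

section Bounds

variable {F : Type*} [Field F] [Fintype F]

/-- `X` is an admissible constant in the large sieve inequality for the symbols attached to `χ`,
with the outer variable running over the finite set `S` and square-free moduli of degree `n`. -/
def SieveBound (χ : MulChar F ℂ) (S : Finset F[X]) (n : ℕ) (X : ℝ) : Prop :=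
  ∀ lam : F[X] → ℂ, ∑ M ∈ S, ‖∑ N ∈ sqfreeDeg F n, lam N * symb χ N M‖ ^ 2 ≤
    X * ∑ N ∈ sqfreeDeg F n, ‖lam N‖ ^ 2

variable {χ : MulChar F ℂ}

lemma SieveBound.mono {S : Finset F[X]} {n : ℕ} {X Y : ℝ} (h : SieveBound χ S n X) (hXY : X ≤ Y) :
    SieveBound χ S n Y := fun lam =>
  (h lam).trans (mul_le_mul_of_nonneg_right hXY (Finset.sum_nonneg fun _ _ => by positivity))

lemma SieveBound.subset {S T : Finset F[X]} {n : ℕ} {X : ℝ} (h : SieveBound χ T n X) (hST : S ⊆ T) :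
    SieveBound χ S n X := fun lam =>
  (Finset.sum_le_sum_of_subset_of_nonneg hST fun _ _ _ => by positivity).trans (h lam)

lemma sqfreeDeg_subset (n : ℕ) : sqfreeDeg F n ⊆ monicDeg F n := fun f hf => by
  rw [mem_sqfreeDeg] at hf
  exact mem_monicDeg.2 hf.1

/-- The duality principle for finite bilinear forms. -/
lemma duality {ι κ : Type*} (s : Finset ι) (t : Finset κ) (a : ι → κ → ℂ) {X : ℝ} (hX : 0 ≤ X)
    (h : ∀ x : κ → ℂ, ∑ i ∈ s, ‖∑ j ∈ t, x j * a i j‖ ^ 2 ≤ X * ∑ j ∈ t, ‖x j‖ ^ 2) (y : ι → ℂ) :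
    ∑ j ∈ t, ‖∑ i ∈ s, y i * a i j‖ ^ 2 ≤ X * ∑ i ∈ s, ‖y i‖ ^ 2 := by
  set T : κ → ℂ := fun j => ∑ i ∈ s, y i * a i j with hT
  set W : ℝ := ∑ j ∈ t, ‖T j‖ ^ 2 with hW
  set R : ι → ℂ := fun i => ∑ j ∈ t, conj (T j) * a i j with hR
  -- the dual sum `W` is the bilinear form evaluated at `y` and `conj T`
  have h1 : (W : ℂ) = ∑ i ∈ s, y i * R i := by
    have : (W : ℂ) = ∑ j ∈ t, conj (T j) * T j := by
      rw [hW]; push_cast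
      refine Finset.sum_congr rfl fun j _ => ?_
      rw [mul_comm, Complex.mul_conj, Complex.normSq_eq_norm_sq]; push_cast; rfl
    rw [this]
    simp_rw [hR, Finset.mul_sum]
    rw [Finset.sum_comm]
    refine Finset.sum_congr rfl fun j _ => ?_
    simp only [hT, Finset.mul_sum]
    refine Finset.sum_congr rfl fun i _ => by ring
  have h2 : ∑ i ∈ s, ‖R i‖ ^ 2 ≤ X * W := by
    have := h fun j => conj (T j)
    simpa [hR, hW] using this
  have hW0 : 0 ≤ W := Finset.sum_nonneg fun _ _ => by positivity
  have h3 : W ≤ ∑ i ∈ s, ‖y i‖ * ‖R i‖ := by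
    have h4 : ‖(W : ℂ)‖ = W := by rw [Complex.norm_real, Real.norm_of_nonneg hW0]
    rw [← h4, h1]
    refine (norm_sum_le _ _).trans (Finset.sum_le_sum fun i _ => by rw [norm_mul])
  have h5 : W ^ 2 ≤ (∑ i ∈ s, ‖y i‖ ^ 2) * (X * W) := by
    calc W ^ 2 ≤ (∑ i ∈ s, ‖y i‖ * ‖R i‖) ^ 2 := pow_le_pow_left₀ hW0 h3 2
      _ ≤ (∑ i ∈ s, ‖y i‖ ^ 2) * ∑ i ∈ s, ‖R i‖ ^ 2 := Finset.sum_mul_sq_le_sq_mul_sq _ _ _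
      _ ≤ _ := mul_le_mul_of_nonneg_left h2 (Finset.sum_nonneg fun _ _ => by positivity)
  rcases hW0.eq_or_lt with h0 | h0
  · rw [← h0]
    exact mul_nonneg hX (Finset.sum_nonneg fun _ _ => by positivity)
  · nlinarith

lemma SieveBound.swap (hneg : χ (-1) = 1) {m n : ℕ} {X : ℝ} (hX : 0 ≤ X)
    (h : SieveBound χ (sqfreeDeg F m) n X) : SieveBound χ (sqfreeDeg F n) m X := by
  intro lam
  have := duality (sqfreeDeg F m) (sqfreeDeg F n) (fun M N => symb χ N M) hX h lam
  simpa only [symb_comm hneg] using this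

/-- The bound coming from the Cauchy–Schwarz inequality alone. -/
lemma sieveBound_trivial (χ : MulChar F ℂ) (m n : ℕ) :
    SieveBound χ (monicDeg F m) n ((Fintype.card F : ℝ) ^ (m + n)) := by
  intro lam
  have h1 : ∀ M ∈ monicDeg F m, ‖∑ N ∈ sqfreeDeg F n, lam N * symb χ N M‖ ^ 2 ≤
      (Fintype.card F : ℝ) ^ n * ∑ N ∈ sqfreeDeg F n, ‖lam N‖ ^ 2 := by
    intro M _
    calc ‖∑ N ∈ sqfreeDeg F n, lam N * symb χ N M‖ ^ 2
        ≤ (∑ N ∈ sqfreeDeg F n, 1 * ‖lam N‖) ^ 2 := by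
          refine pow_le_pow_left₀ (norm_nonneg _) ((norm_sum_le _ _).trans
            (Finset.sum_le_sum fun N hN => ?_)) 2
          rw [norm_mul, one_mul]
          exact mul_le_of_le_one_right (norm_nonneg _)
            (norm_symb_le_one (mem_sqfreeDeg.1 hN).1.1)
      _ ≤ (∑ N ∈ sqfreeDeg F n, 1 ^ 2) * ∑ N ∈ sqfreeDeg F n, ‖lam N‖ ^ 2 :=
          Finset.sum_mul_sq_le_sq_mul_sq _ _ _
      _ ≤ _ := by
          refine mul_le_mul_of_nonneg_right ?_ (Finset.sum_nonneg fun _ _ => by positivity)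
          have := Finset.card_le_card (sqfreeDeg_subset (F := F) n)
          rw [card_monicDeg] at this
          simp only [one_pow, Finset.sum_const, nsmul_eq_mul, mul_one]
          exact_mod_cast this
  refine (Finset.sum_le_sum h1).trans ?_
  rw [Finset.sum_const, card_monicDeg, nsmul_eq_mul, pow_add]
  push_cast
  rw [mul_assoc]

end Bounds

/-! ### The recursive inequality -/

section PoissonStep

variable {F : Type*} [Field F] [Fintype F] {χ : MulChar F ℂ}

open scoped Classical in
/-- A sum over the nonzero polynomials of degree less than `r`, sorted by degree and leading
coefficient. -/
lemma sum_lowDeg_eq (r : ℕ) (g : F[X] → ℝ) (h0 : g 0 = 0) :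
    ∑ V ∈ lowDeg F r, g V =
      ∑ j ∈ Finset.range r, ∑ c : Fˣ, ∑ M ∈ monicDeg F j, g (C (c : F) * M) := by
  induction r with
  | zero =>
    have : lowDeg F 0 = {0} := by
      ext f
      simp [degree_eq_bot]
    rw [this]; simp [h0]
  | succ r ih =>
    rw [Finset.sum_range_succ, ← ih]
    have hsub : lowDeg F r ⊆ lowDeg F (r + 1) := fun f hf => by
      rw [mem_lowDeg] at hf ⊢
      exact hf.trans (by exact_mod_cast Nat.lt_succ_self r)
    rw [← Finset.sum_sdiff hsub, add_comm]
    congr 1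
    rw [← Finset.sum_product']
    have hdeg : ∀ V, V ∈ lowDeg F (r + 1) \ lowDeg F r ↔ V.degree = r := by
      intro V
      rw [Finset.mem_sdiff, mem_lowDeg, mem_lowDeg]
      rcases eq_or_ne V 0 with rfl | hV
      · simp
      · rw [degree_eq_natDegree hV]
        norm_cast
        omega
    symm
    refine Finset.sum_bij (fun p _ => C (p.1 : F) * p.2) ?_ ?_ ?_ fun _ _ => rfl
    · intro p hp
      obtain ⟨h1, h2⟩ := mem_monicDeg.1 (Finset.mem_product.1 hp).2
      rw [hdeg, degree_C_mul p.1.ne_zero, degree_eq_natDegree h1.ne_zero, h2]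
    · intro p hp p' hp' h
      obtain ⟨h1, -⟩ := mem_monicDeg.1 (Finset.mem_product.1 hp).2
      obtain ⟨h1', -⟩ := mem_monicDeg.1 (Finset.mem_product.1 hp').2
      have h3 := congrArg leadingCoeff h
      simp only [leadingCoeff_mul, leadingCoeff_C, h1.leadingCoeff, h1'.leadingCoeff, mul_one] at h3
      have h4 : p.1 = p'.1 := Units.ext h3
      refine Prod.ext h4 ?_
      rw [h4] at h
      exact mul_left_cancel₀ (C_ne_zero.2 p'.1.ne_zero) h
    · intro V hV
      rw [hdeg] at hV
      have hV0 : V ≠ 0 := by rintro rfl; simp at hV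
      have hl : V.leadingCoeff ≠ 0 := leadingCoeff_ne_zero.2 hV0
      refine ⟨(Units.mk0 _ hl, C (V.leadingCoeff)⁻¹ * V), ?_, ?_⟩
      · rw [Finset.mem_product, mem_monicDeg]
        refine ⟨Finset.mem_univ _, ?_, ?_⟩
        · rw [mul_comm]; exact monic_mul_leadingCoeff_inv hV0
        · rw [natDegree_C_mul (inv_ne_zero hl)]
          exact natDegree_eq_of_degree_eq_some hV
      · rw [Units.val_mk0, ← mul_assoc, ← C_mul, mul_inv_cancel₀ hl, C_1, one_mul]

open scoped Classical in
/-- The dual sum runs over all polynomials of degree less than `r`, including non-monic ones. -/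
lemma sum_lowDeg_norm_sq_le {a r : ℕ} (ha : 1 ≤ a) {X : ℝ} (hX : 0 ≤ X)
    (H : ∀ j < r, SieveBound χ (monicDeg F j) a X) (x : F[X] → ℂ) :
    ∑ V ∈ lowDeg F r, ‖∑ A ∈ sqfreeDeg F a, x A * symb χ A V‖ ^ 2 ≤
      Fintype.card F * r * X * ∑ A ∈ sqfreeDeg F a, ‖x A‖ ^ 2 := by
  set S := ∑ A ∈ sqfreeDeg F a, ‖x A‖ ^ 2 with hS
  have hS0 : 0 ≤ S := Finset.sum_nonneg fun _ _ => by positivity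
  rw [sum_lowDeg_eq]
  · have h1 : ∀ j ∈ Finset.range r, ∀ c : Fˣ,
        ∑ M ∈ monicDeg F j, ‖∑ A ∈ sqfreeDeg F a, x A * symb χ A (C (c : F) * M)‖ ^ 2 ≤ X * S := by
      intro j hj c
      have h2 := H j (Finset.mem_range.1 hj) fun A => x A * symb χ A (C (c : F))
      calc ∑ M ∈ monicDeg F j, ‖∑ A ∈ sqfreeDeg F a, x A * symb χ A (C (c : F) * M)‖ ^ 2
          = ∑ M ∈ monicDeg F j,
              ‖∑ A ∈ sqfreeDeg F a, x A * symb χ A (C (c : F)) * symb χ A M‖ ^ 2 := by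
            refine Finset.sum_congr rfl fun M _ => ?_
            congr 2
            refine Finset.sum_congr rfl fun A hA => ?_
            rw [symb_mul_right (mem_sqfreeDeg.1 hA).1.1, mul_assoc]
        _ ≤ _ := h2
        _ ≤ X * S := by
            refine mul_le_mul_of_nonneg_left (Finset.sum_le_sum fun A hA => ?_) hX
            refine pow_le_pow_left₀ (norm_nonneg _) ?_ 2
            rw [norm_mul]
            exact mul_le_of_le_one_right (norm_nonneg _)
              (norm_symb_le_one (mem_sqfreeDeg.1 hA).1.1)
    calc _ ≤ ∑ j ∈ Finset.range r, ∑ c : Fˣ, X * S :=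
          Finset.sum_le_sum fun j hj => Finset.sum_le_sum fun c _ => h1 j hj c
      _ = r * ((Fintype.card Fˣ : ℕ) : ℝ) * (X * S) := by
          simp [mul_assoc]
      _ ≤ r * (Fintype.card F : ℝ) * (X * S) := by
          have : Fintype.card Fˣ ≤ Fintype.card F :=
            Fintype.card_le_of_injective _ Units.val_injective
          have : ((Fintype.card Fˣ : ℕ) : ℝ) ≤ Fintype.card F := by exact_mod_cast this
          gcongr
      _ = _ := by ring
  · have : ∀ A ∈ sqfreeDeg F a, x A * symb χ A 0 = 0 := by
      intro A hA
      obtain ⟨⟨h1, h2⟩, -⟩ := mem_sqfreeDeg.1 hA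
      rw [symb_eq_zero h1, mul_zero]
      rw [isCoprime_zero_right]
      intro hu
      rw [h1.eq_one_of_isUnit hu, natDegree_one] at h2
      omega
    rw [Finset.sum_congr rfl this]; simp

open scoped Classical in
/-- Interchanging a sum over `A` with a sum over the divisors of `A`. -/
lemma sum_sum_dvd_le {n a : ℕ} (han : a ≤ n) {Y : ℝ}
    (hY : ∀ D ∈ sqfreeLE F n, (((sqfreeLE F n).filter (· ∣ D)).card : ℝ) ≤ Y) (g : F[X] → ℝ)
    (hg : ∀ A, 0 ≤ g A) :
    ∑ f ∈ sqfreeLE F n, ∑ A ∈ sqfreeDeg F a, (if f ∣ A then g A else 0) ≤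
      Y * ∑ A ∈ sqfreeDeg F a, g A := by
  rw [Finset.sum_comm, Finset.mul_sum]
  refine Finset.sum_le_sum fun A hA => ?_
  rw [← Finset.sum_filter, Finset.sum_const, nsmul_eq_mul]
  refine mul_le_mul_of_nonneg_right (hY A ?_) (hg A)
  obtain ⟨⟨h1, h2⟩, h3⟩ := mem_sqfreeDeg.1 hA
  exact mem_sqfreeLE.2 ⟨h1, by omega, h3⟩

open scoped Classical in
/-- The contribution of the coprime pairs after Poisson summation. -/
lemma norm_sum_coprime_pairs_le (hχ : χ ≠ 1) (hneg : χ (-1) = 1) {n a k : ℕ} (ha : 1 ≤ a)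
    (han : a ≤ n) {Y Z : ℝ} (hZ : 0 ≤ Z)
    (hY : ∀ D ∈ sqfreeLE F n, (((sqfreeLE F n).filter (· ∣ D)).card : ℝ) ≤ Y)
    (H : ∀ j, j + k < 2 * a → SieveBound χ (monicDeg F j) a
      (Z * (Fintype.card F : ℝ) ^ a / (Fintype.card F : ℝ) ^ k)) (p : F[X] → ℂ) :
    ‖∑ A ∈ sqfreeDeg F a, ∑ B ∈ sqfreeDeg F a, (if IsCoprime A B then
        p A * conj (p B) * ∑ M ∈ monicDeg F k, symb χ A M * conj (symb χ B M) else 0)‖ ≤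
      Y * (Fintype.card F * (2 * n)) * Z * ∑ A ∈ sqfreeDeg F a, ‖p A‖ ^ 2 := by
  obtain ⟨ψ, hψ⟩ : ∃ ψ : AddChar F ℂ, ψ ≠ 1 := by
    obtain ⟨ψ, hψ⟩ := AddChar.exists_apply_ne_zero.2 (one_ne_zero (α := F))
    exact ⟨ψ, fun h => hψ (by rw [h]; rfl)⟩
  have hcex : ∀ A : F[X], ∃ c : ℂ, A ∈ sqfreeDeg F a →
      ‖c‖ ^ 2 = ((Fintype.card F : ℝ) ^ a)⁻¹ ∧ ∀ M, symb χ A M =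
        c * ∑ u ∈ lowDeg F A.natDegree, conj (symb χ A u) * addCharMod ψ A (u * M) := by
    intro A
    by_cases hA : A ∈ sqfreeDeg F a
    · obtain ⟨⟨h1, h2⟩, h3⟩ := mem_sqfreeDeg.1 hA
      obtain ⟨c, hc⟩ := exists_gauss (ψ := ψ) hχ hψ h1 h3
      rw [h2] at hc
      exact ⟨c, fun _ => by rw [h2]; exact hc⟩
    · exact ⟨0, fun h => absurd h hA⟩
  choose c hc using hcex
  set q : ℝ := (Fintype.card F : ℝ) with hq
  have hq0 : 0 < q := by rw [hq]; exact_mod_cast Fintype.card_pos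
  set r := 2 * a - k with hr
  set X := Z * q ^ a / q ^ k with hX
  have hX0 : 0 ≤ X := by positivity
  have HX : ∀ j < r, SieveBound χ (monicDeg F j) a X := fun j hj => H j (by omega)
  -- the condition that `A` and `B` be coprime is replaced by a Möbius sum over common divisors `f`;
  -- the factor `f` is kept inside `A` and `B`, so the degrees do not change
  let x : F[X] → F[X] → ℂ := fun f A => if f ∣ A then conj (p A * c A) else 0
  let y : F[X] → F[X] → ℂ := fun f B =>
    if f ∣ B then conj (p B * c B) * conj (symb χ B (-1)) else 0
  let U : F[X] → F[X] → ℂ := fun f V => ∑ A ∈ sqfreeDeg F a, x f A * symb χ A V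
  let W : F[X] → F[X] → ℂ := fun f V => ∑ B ∈ sqfreeDeg F a, y f B * symb χ B V
  have hmain : ∑ A ∈ sqfreeDeg F a, ∑ B ∈ sqfreeDeg F a, (if IsCoprime A B then
        p A * conj (p B) * ∑ M ∈ monicDeg F k, symb χ A M * conj (symb χ B M) else 0) =
      (Fintype.card F : ℂ) ^ k * ∑ f ∈ sqfreeLE F n, moebius f * ∑ V ∈ lowDeg F r,
        ψ (V.coeff (r - 1)) * (conj (U f V) * W f V) := by
    have h1 : ∀ A ∈ sqfreeDeg F a, ∀ B ∈ sqfreeDeg F a, (if IsCoprime A B then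
        p A * conj (p B) * ∑ M ∈ monicDeg F k, symb χ A M * conj (symb χ B M) else 0) =
        ∑ f ∈ sqfreeLE F n, ∑ V ∈ lowDeg F r, (Fintype.card F : ℂ) ^ k * (moebius f *
          (ψ (V.coeff (r - 1)) * (conj (x f A * symb χ A V) * (y f B * symb χ B V)))) := by
      intro A hA B hB
      obtain ⟨⟨hAm, hAd⟩, hAs⟩ := mem_sqfreeDeg.1 hA
      obtain ⟨⟨hBm, hBd⟩, hBs⟩ := mem_sqfreeDeg.1 hB
      have hmob := sum_moebius_dvd_dvd (n := n) (D := A)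
        (mem_sqfreeLE.2 ⟨hAm, by omega, hAs⟩) B
      set Q : ℂ := (Fintype.card F : ℂ) ^ k * ∑ V ∈ lowDeg F r, ψ (V.coeff (r - 1)) *
        (conj (conj (p A * c A) * symb χ A V) *
          (conj (p B * c B) * conj (symb χ B (-1)) * symb χ B V)) with hQ
      have h2 : ∀ f ∈ sqfreeLE F n, ∑ V ∈ lowDeg F r, (Fintype.card F : ℂ) ^ k * (moebius f *
          (ψ (V.coeff (r - 1)) * (conj (x f A * symb χ A V) * (y f B * symb χ B V)))) =
          (if f ∣ A ∧ f ∣ B then moebius f else 0) * Q := by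
        intro f _
        by_cases hfA : f ∣ A
        · by_cases hfB : f ∣ B
          · rw [if_pos ⟨hfA, hfB⟩, hQ, Finset.mul_sum, Finset.mul_sum]
            refine Finset.sum_congr rfl fun V _ => ?_
            simp only [x, y, if_pos hfA, if_pos hfB]
            ring
          · rw [if_neg fun h => hfB h.2, zero_mul]
            refine Finset.sum_eq_zero fun V _ => ?_
            simp [y, if_neg hfB]
        · rw [if_neg fun h => hfA h.1, zero_mul]
          refine Finset.sum_eq_zero fun V _ => ?_
          simp [x, if_neg hfA]
      rw [Finset.sum_congr rfl h2, ← Finset.sum_mul, hmob]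
      split_ifs with hAB
      · rw [sum_monicDeg_symb_mul_conj hψ hneg hAm hBm hAB (hc A hA).2 (hc B hB).2 k, one_mul, hQ,
          hAd, hBd, ← two_mul, ← hr, Finset.mul_sum, Finset.mul_sum, Finset.mul_sum]
        refine Finset.sum_congr rfl fun V _ => ?_
        simp only [map_mul, Complex.conj_conj]
        ring
      · rw [zero_mul]
    rw [Finset.sum_congr rfl fun A hA => Finset.sum_congr rfl fun B hB => h1 A hA B hB]
    rw [Finset.sum_congr rfl fun A _ => Finset.sum_comm, Finset.sum_comm, Finset.mul_sum]
    refine Finset.sum_congr rfl fun f _ => ?_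
    rw [Finset.sum_congr rfl fun A _ => Finset.sum_comm, Finset.sum_comm, Finset.mul_sum,
      Finset.mul_sum]
    refine Finset.sum_congr rfl fun V _ => ?_
    simp only [U, W]
    rw [map_sum, Finset.sum_mul_sum, Finset.mul_sum, Finset.mul_sum, Finset.mul_sum]
    refine Finset.sum_congr rfl fun A _ => ?_
    rw [Finset.mul_sum, Finset.mul_sum, Finset.mul_sum]
  rw [hmain, norm_mul, norm_pow, Complex.norm_natCast, ← hq]
  have hxn : ∀ f, ∀ A ∈ sqfreeDeg F a, ‖x f A‖ ^ 2 ≤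
      if f ∣ A then ‖p A‖ ^ 2 * (q ^ a)⁻¹ else 0 := by
    intro f A hA
    by_cases hfA : f ∣ A
    · simp only [x, if_pos hfA]
      rw [RCLike.norm_conj, norm_mul, mul_pow, (hc A hA).1]
    · simp [x, if_neg hfA]
  have hyn : ∀ f, ∀ A ∈ sqfreeDeg F a, ‖y f A‖ ^ 2 ≤
      if f ∣ A then ‖p A‖ ^ 2 * (q ^ a)⁻¹ else 0 := by
    intro f A hA
    by_cases hfA : f ∣ A
    · simp only [y, if_pos hfA]
      rw [norm_mul, RCLike.norm_conj, RCLike.norm_conj, mul_pow, norm_mul, mul_pow, (hc A hA).1]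
      refine mul_le_of_le_one_right (by positivity) (pow_le_one₀ (norm_nonneg _)
        (norm_symb_le_one (mem_sqfreeDeg.1 hA).1.1))
    · simp [y, if_neg hfA]
  let g : F[X] → ℝ := fun f => ∑ A ∈ sqfreeDeg F a, if f ∣ A then ‖p A‖ ^ 2 * (q ^ a)⁻¹ else 0
  have hfb : ∀ f ∈ sqfreeLE F n, ‖moebius f * ∑ V ∈ lowDeg F r,
        ψ (V.coeff (r - 1)) * (conj (U f V) * W f V)‖ ≤ q * r * X * g f := by
    intro f _
    have hU : ∑ V ∈ lowDeg F r, ‖U f V‖ ^ 2 ≤ q * r * X * g f :=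
      (sum_lowDeg_norm_sq_le ha hX0 HX (x f)).trans
        (mul_le_mul_of_nonneg_left (Finset.sum_le_sum (hxn f)) (by positivity))
    have hW : ∑ V ∈ lowDeg F r, ‖W f V‖ ^ 2 ≤ q * r * X * g f :=
      (sum_lowDeg_norm_sq_le ha hX0 HX (y f)).trans
        (mul_le_mul_of_nonneg_left (Finset.sum_le_sum (hyn f)) (by positivity))
    rw [norm_mul, norm_moebius, one_mul]
    calc _ ≤ ∑ V ∈ lowDeg F r, ‖ψ (V.coeff (r - 1)) * (conj (U f V) * W f V)‖ := norm_sum_le _ _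
      _ ≤ ∑ V ∈ lowDeg F r, (‖U f V‖ ^ 2 + ‖W f V‖ ^ 2) / 2 := by
          refine Finset.sum_le_sum fun V _ => ?_
          rw [norm_mul, norm_mul, RCLike.norm_conj, AddChar.norm_apply, one_mul]
          nlinarith [sq_nonneg (‖U f V‖ - ‖W f V‖)]
      _ = (∑ V ∈ lowDeg F r, ‖U f V‖ ^ 2 + ∑ V ∈ lowDeg F r, ‖W f V‖ ^ 2) / 2 := by
          rw [← Finset.sum_div, Finset.sum_add_distrib]
      _ ≤ _ := by linarith
  have hr2 : (r : ℝ) ≤ 2 * n := by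
    have : r ≤ 2 * n := by omega
    exact_mod_cast this
  have hgs : ∑ f ∈ sqfreeLE F n, g f ≤
      Y * ∑ A ∈ sqfreeDeg F a, ‖p A‖ ^ 2 * (q ^ a)⁻¹ :=
    sum_sum_dvd_le han hY _ fun A => by positivity
  have hg0 : 0 ≤ ∑ f ∈ sqfreeLE F n, g f :=
    Finset.sum_nonneg fun f _ => Finset.sum_nonneg fun A _ => by split_ifs <;> positivity
  calc q ^ k * _ ≤ q ^ k * ∑ f ∈ sqfreeLE F n, q * r * X * g f :=
        mul_le_mul_of_nonneg_left ((norm_sum_le _ _).trans (Finset.sum_le_sum hfb)) (by positivity)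
    _ = q ^ k * (q * r * X * ∑ f ∈ sqfreeLE F n, g f) := by rw [← Finset.mul_sum]
    _ ≤ q ^ k * (q * (2 * n) * X * (Y * ∑ A ∈ sqfreeDeg F a, ‖p A‖ ^ 2 * (q ^ a)⁻¹)) := by
        gcongr
    _ = Y * (q * (2 * n)) * Z * ∑ A ∈ sqfreeDeg F a, ‖p A‖ ^ 2 := by
        rw [← Finset.sum_mul, hX]
        field_simp

end PoissonStep

section PoissonBound

variable {F : Type*} [Field F] [Fintype F] {χ : MulChar F ℂ}

lemma sum_monicDeg_dvd {E : F[X]} (hE : E.Monic) (m : ℕ) (g : F[X] → ℂ)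
    [DecidablePred fun M => E ∣ M] :
    ∑ M ∈ monicDeg F m, (if E ∣ M then g M else 0) =
      if E.natDegree ≤ m then ∑ M ∈ monicDeg F (m - E.natDegree), g (E * M) else 0 := by
  rw [← Finset.sum_filter]
  split_ifs with h
  · refine Finset.sum_nbij' (fun M => M /ₘ E) (fun M => E * M) ?_ ?_ ?_ ?_ ?_
    · intro M hM
      obtain ⟨h1, h2⟩ := Finset.mem_filter.1 hM
      obtain ⟨h3, h4⟩ := mem_monicDeg.1 h1
      have he := mul_divByMonic_of_dvd hE h2
      have hm : (M /ₘ E).Monic := hE.of_mul_monic_left (by rwa [he])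
      have := hE.natDegree_mul hm
      rw [he, h4] at this
      exact mem_monicDeg.2 ⟨hm, by omega⟩
    · intro M hM
      obtain ⟨h3, h4⟩ := mem_monicDeg.1 hM
      rw [Finset.mem_filter, mem_monicDeg, hE.natDegree_mul h3]
      exact ⟨⟨hE.mul h3, by omega⟩, dvd_mul_right _ _⟩
    · intro M hM
      exact mul_divByMonic_of_dvd hE (Finset.mem_filter.1 hM).2
    · intro M _
      exact mul_divByMonic_cancel_left _ hE
    · intro M hM
      rw [mul_divByMonic_of_dvd hE (Finset.mem_filter.1 hM).2]
  · refine Finset.sum_eq_zero fun M hM => ?_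
    obtain ⟨h1, h2⟩ := Finset.mem_filter.1 hM
    obtain ⟨h3, h4⟩ := mem_monicDeg.1 h1
    exact absurd (h4 ▸ natDegree_le_of_dvd h2 h3.ne_zero) h

open scoped Classical in
/-- The contribution of the pairs with a given greatest common divisor `D`. -/
lemma norm_sum_pairs_gcd_le (hχ : χ ≠ 1) (hneg : χ (-1) = 1) {m n a : ℕ} (ha : 1 ≤ a)
    {D : F[X]} (hD : D ∈ sqfreeLE F n) (hDa : D.natDegree + a = n) {Y Z : ℝ} (hZ : 0 ≤ Z)
    (hY : ∀ D ∈ sqfreeLE F n, (((sqfreeLE F n).filter (· ∣ D)).card : ℝ) ≤ Y)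
    (H : ∀ k j, k ≤ m → m + a ≤ n + k → j + k < 2 * a → SieveBound χ (monicDeg F j) a
      (Z * (Fintype.card F : ℝ) ^ a / (Fintype.card F : ℝ) ^ k)) (p : F[X] → ℂ) :
    ‖∑ A ∈ sqfreeDeg F a, ∑ B ∈ sqfreeDeg F a, (if IsCoprime A B then
        p A * conj (p B) * ∑ M ∈ monicDeg F m, symb χ (D * A) M * conj (symb χ (D * B) M)
          else 0)‖ ≤
      Y * (Y * (Fintype.card F * (2 * n)) * Z * ∑ A ∈ sqfreeDeg F a, ‖p A‖ ^ 2) := by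
  obtain ⟨hDm, hDn, hDs⟩ := mem_sqfreeLE.1 hD
  have hY0 : 0 ≤ Y := le_trans (Nat.cast_nonneg _) (hY D hD)
  set R : ℝ := Y * (Fintype.card F * (2 * n)) * Z * ∑ A ∈ sqfreeDeg F a, ‖p A‖ ^ 2 with hR
  have hR0 : 0 ≤ R := mul_nonneg (by positivity) (Finset.sum_nonneg fun _ _ => by positivity)
  have hin : ∀ A ∈ sqfreeDeg F a, ∀ B ∈ sqfreeDeg F a,
      ∑ M ∈ monicDeg F m, symb χ (D * A) M * conj (symb χ (D * B) M) =
      ∑ E ∈ sqfreeLE F n, if E ∣ D ∧ E.natDegree ≤ m then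
        moebius E * (symb χ A E * conj (symb χ B E)) * ∑ M ∈ monicDeg F (m - E.natDegree),
          symb χ A M * conj (symb χ B M) else 0 := by
    intro A hA B hB
    have hAm := (mem_sqfreeDeg.1 hA).1.1
    have hBm := (mem_sqfreeDeg.1 hB).1.1
    have h1 : ∀ M, symb χ (D * A) M * conj (symb χ (D * B) M) =
        ∑ E ∈ sqfreeLE F n, if E ∣ D then moebius E *
          (if E ∣ M then symb χ A M * conj (symb χ B M) else 0) else 0 := by
      intro M
      have h2 : symb χ (D * A) M * conj (symb χ (D * B) M) =
          (if IsCoprime D M then 1 else 0) * (symb χ A M * conj (symb χ B M)) := by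
        rw [symb_mul_left hDm hAm, symb_mul_left hDm hBm, map_mul, mul_mul_mul_comm]
        split_ifs with h
        · rw [symb_mul_conj hDm h]
        · rw [symb_eq_zero hDm h, zero_mul]
      rw [h2, ← sum_moebius_dvd_dvd hD M, Finset.sum_mul]
      refine Finset.sum_congr rfl fun E _ => ?_
      by_cases hED : E ∣ D <;> by_cases hEM : E ∣ M <;> simp [hED, hEM]
    simp_rw [h1]
    rw [Finset.sum_comm]
    refine Finset.sum_congr rfl fun E hE => ?_
    have hEm := (mem_sqfreeLE.1 hE).1
    by_cases hED : E ∣ D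
    · simp only [hED, if_true, true_and]
      rw [← Finset.mul_sum, sum_monicDeg_dvd hEm]
      split_ifs with hdeg
      · rw [mul_assoc]
        congr 1
        rw [Finset.mul_sum]
        refine Finset.sum_congr rfl fun M _ => ?_
        rw [symb_mul_right hAm, symb_mul_right hBm, map_mul]
        ring
      · rw [mul_zero]
    · simp [hED]
  have hsum : ∑ A ∈ sqfreeDeg F a, ∑ B ∈ sqfreeDeg F a, (if IsCoprime A B then
        p A * conj (p B) * ∑ M ∈ monicDeg F m, symb χ (D * A) M * conj (symb χ (D * B) M)
          else 0) =
      ∑ E ∈ sqfreeLE F n, if E ∣ D ∧ E.natDegree ≤ m then moebius E *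
        ∑ A ∈ sqfreeDeg F a, ∑ B ∈ sqfreeDeg F a, (if IsCoprime A B then
          (p A * symb χ A E) * conj (p B * symb χ B E) * ∑ M ∈ monicDeg F (m - E.natDegree),
            symb χ A M * conj (symb χ B M) else 0) else 0 := by
    have h1 : ∀ A ∈ sqfreeDeg F a, ∀ B ∈ sqfreeDeg F a, (if IsCoprime A B then
        p A * conj (p B) * ∑ M ∈ monicDeg F m, symb χ (D * A) M * conj (symb χ (D * B) M)
          else 0) = ∑ E ∈ sqfreeLE F n, if E ∣ D ∧ E.natDegree ≤ m then moebius E *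
          (if IsCoprime A B then (p A * symb χ A E) * conj (p B * symb χ B E) *
            ∑ M ∈ monicDeg F (m - E.natDegree), symb χ A M * conj (symb χ B M) else 0) else 0 := by
      intro A hA B hB
      rw [hin A hA B hB]
      split_ifs with hAB
      · rw [Finset.mul_sum]
        refine Finset.sum_congr rfl fun E _ => ?_
        split_ifs
        · rw [map_mul]; ring
        · rw [mul_zero]
      · simp
    rw [Finset.sum_congr rfl fun A hA => Finset.sum_congr rfl fun B hB => h1 A hA B hB]
    rw [Finset.sum_congr rfl fun A _ => Finset.sum_comm, Finset.sum_comm]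
    refine Finset.sum_congr rfl fun E _ => ?_
    split_ifs
    · simp_rw [Finset.mul_sum]
    · simp
  rw [hsum]
  refine (norm_sum_le _ _).trans ?_
  have hE : ∀ E ∈ sqfreeLE F n, ‖if E ∣ D ∧ E.natDegree ≤ m then moebius E *
        ∑ A ∈ sqfreeDeg F a, ∑ B ∈ sqfreeDeg F a, (if IsCoprime A B then
          (p A * symb χ A E) * conj (p B * symb χ B E) * ∑ M ∈ monicDeg F (m - E.natDegree),
            symb χ A M * conj (symb χ B M) else 0) else 0‖ ≤ if E ∣ D then R else 0 := by
    intro E _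
    by_cases hED : E ∣ D
    · by_cases hEm : E.natDegree ≤ m
      · have hdeg := natDegree_le_of_dvd hED hDm.ne_zero
        rw [if_pos ⟨hED, hEm⟩, if_pos hED, norm_mul, norm_moebius, one_mul]
        refine (norm_sum_coprime_pairs_le hχ hneg ha (by omega) hZ hY
          (fun j hj => H _ j (by omega) (by omega) hj) fun A => p A * symb χ A E).trans ?_
        rw [hR]
        refine mul_le_mul_of_nonneg_left (Finset.sum_le_sum fun A hA => ?_) (by positivity)
        refine pow_le_pow_left₀ (norm_nonneg _) ?_ 2
        rw [norm_mul]
        exact mul_le_of_le_one_right (norm_nonneg _)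
          (norm_symb_le_one (mem_sqfreeDeg.1 hA).1.1)
      · rw [if_neg fun h => hEm h.2, norm_zero]
        rw [if_pos hED]
        exact hR0
    · rw [if_neg fun h => hED h.1, if_neg hED, norm_zero]
  refine (Finset.sum_le_sum hE).trans ?_
  rw [← Finset.sum_filter, Finset.sum_const, nsmul_eq_mul]
  exact mul_le_mul_of_nonneg_right (hY D hD) hR0

open scoped Classical in
/-- The recursive inequality furnished by Poisson summation: up to divisor functions, the large sieve
constant at `(m, n)` is controlled by `q ^ m` and by `q ^ (k - a)` times the constants at `(j, a)`
with `j < 2 * a - k`. -/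
theorem sieveBound_of_poisson (hχ : χ ≠ 1) (hneg : χ (-1) = 1) {m n : ℕ} {Y Z : ℝ} (hZ : 0 ≤ Z)
    (hY : ∀ D ∈ sqfreeLE F n, (((sqfreeLE F n).filter (· ∣ D)).card : ℝ) ≤ Y)
    (H : ∀ a k j, 1 ≤ a → a ≤ n → k ≤ m → m + a ≤ n + k → j + k < 2 * a →
      SieveBound χ (monicDeg F j) a (Z * (Fintype.card F : ℝ) ^ a / (Fintype.card F : ℝ) ^ k)) :
    SieveBound χ (monicDeg F m) n
      ((Fintype.card F : ℝ) ^ m + Y ^ 3 * (Fintype.card F * (2 * n)) * Z) := by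
  intro lam
  set l : F[X] → ℂ := fun N => if N ∈ sqfreeDeg F n then lam N else 0 with hl
  set S := ∑ N ∈ sqfreeDeg F n, ‖lam N‖ ^ 2 with hS
  have hlS : ∑ N ∈ sqfreeDeg F n, ‖l N‖ ^ 2 = S :=
    Finset.sum_congr rfl fun N hN => by simp only [hl, if_pos hN]
  set q : ℝ := (Fintype.card F : ℝ) with hq
  have h1mem : (1 : F[X]) ∈ sqfreeLE F n := mem_sqfreeLE.2 ⟨monic_one, by simp, squarefree_one⟩
  have hY0 : 0 ≤ Y := le_trans (Nat.cast_nonneg _) (hY 1 h1mem)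
  set G : F[X] → F[X] → ℂ := fun N₁ N₂ => l N₁ * conj (l N₂) *
    ∑ M ∈ monicDeg F m, symb χ N₁ M * conj (symb χ N₂ M) with hG
  have hT : ((∑ M ∈ monicDeg F m, ‖∑ N ∈ sqfreeDeg F n, lam N * symb χ N M‖ ^ 2 : ℝ) : ℂ) =
      ∑ N₁ ∈ sqfreeDeg F n, ∑ N₂ ∈ sqfreeDeg F n, G N₁ N₂ := by
    have h1 : ∀ M, ((‖∑ N ∈ sqfreeDeg F n, lam N * symb χ N M‖ ^ 2 : ℝ) : ℂ) =
        ∑ N₁ ∈ sqfreeDeg F n, ∑ N₂ ∈ sqfreeDeg F n,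
          l N₁ * conj (l N₂) * (symb χ N₁ M * conj (symb χ N₂ M)) := by
      intro M
      rw [← Complex.normSq_eq_norm_sq, ← Complex.mul_conj, map_sum, Finset.sum_mul_sum]
      refine Finset.sum_congr rfl fun N₁ h₁ => Finset.sum_congr rfl fun N₂ h₂ => ?_
      simp only [hl, if_pos h₁, if_pos h₂, map_mul]
      ring
    rw [Complex.ofReal_sum, Finset.sum_congr rfl fun M _ => h1 M, Finset.sum_comm]
    refine Finset.sum_congr rfl fun N₁ _ => ?_
    rw [Finset.sum_comm]
    refine Finset.sum_congr rfl fun N₂ _ => ?_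
    simp only [hG, Finset.mul_sum]
  rw [sum_sqfreeDeg_pairs n G (by
    intro N₁ N₂ h
    simp only [hG, hl]
    by_cases h1 : N₁ ∈ sqfreeDeg F n
    · rw [if_neg fun h2 => h ⟨h1, h2⟩]; simp
    · rw [if_neg h1]; simp)] at hT
  have hT0 : 0 ≤ ∑ M ∈ monicDeg F m, ‖∑ N ∈ sqfreeDeg F n, lam N * symb χ N M‖ ^ 2 :=
    Finset.sum_nonneg fun _ _ => by positivity
  rw [← Real.norm_of_nonneg hT0, ← Complex.norm_real, hT]
  set P : F[X] → ℝ := fun D => ∑ A ∈ sqfreeDeg F (n - D.natDegree), ‖l (D * A)‖ ^ 2 with hP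
  have hP0 : ∀ D, 0 ≤ P D := fun D => Finset.sum_nonneg fun _ _ => by positivity
  have hD : ∀ D ∈ sqfreeLE F n, ‖∑ A ∈ sqfreeDeg F (n - D.natDegree),
      ∑ B ∈ sqfreeDeg F (n - D.natDegree), if IsCoprime A B then G (D * A) (D * B) else 0‖ ≤
      q ^ m * (if D.natDegree = n then ‖l D‖ ^ 2 else 0) +
        Y ^ 2 * (q * (2 * n)) * Z * P D := by
    intro D hD
    obtain ⟨hDm, hDn, hDs⟩ := mem_sqfreeLE.1 hD
    -- the greatest common divisor has full degree exactly on the diagonal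
    by_cases hdeg : D.natDegree = n
    · have h1 : sqfreeDeg F (n - D.natDegree) = {1} := by
        ext f
        rw [hdeg, Nat.sub_self, mem_sqfreeDeg, Finset.mem_singleton]
        constructor
        · rintro ⟨⟨h1, h2⟩, -⟩
          exact h1.natDegree_eq_zero.1 h2
        · rintro rfl
          exact ⟨⟨monic_one, natDegree_one⟩, squarefree_one⟩
      have h2 : 0 ≤ Y ^ 2 * (q * (2 * n)) * Z * P D := mul_nonneg (by positivity) (hP0 D)
      refine le_trans ?_ (le_add_of_nonneg_right h2)
      rw [h1, Finset.sum_singleton, Finset.sum_singleton, if_pos isCoprime_one_left, mul_one,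
        if_pos hdeg]
      simp only [hG]
      rw [norm_mul, norm_mul, RCLike.norm_conj, ← sq, mul_comm]
      refine mul_le_mul_of_nonneg_right ?_ (by positivity)
      refine (norm_sum_le _ _).trans ?_
      calc ∑ M ∈ monicDeg F m, ‖symb χ D M * conj (symb χ D M)‖ ≤ ∑ M ∈ monicDeg F m, (1 : ℝ) := by
            refine Finset.sum_le_sum fun M _ => ?_
            rw [norm_mul, RCLike.norm_conj]
            exact mul_le_one₀ (norm_symb_le_one hDm) (norm_nonneg _) (norm_symb_le_one hDm)
        _ = q ^ m := by rw [Finset.sum_const, card_monicDeg]; simp [hq]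
    · rw [if_neg hdeg, mul_zero, zero_add]
      refine (norm_sum_pairs_gcd_le (m := m) hχ hneg (a := n - D.natDegree) (by omega) hD (by omega)
        hZ hY (fun k j h1 h2 h3 => H _ k j (by omega) (by omega) h1 h2 h3)
        fun A => l (D * A)).trans (le_of_eq ?_)
      rw [hP]; ring
  refine ((norm_sum_le _ _).trans (Finset.sum_le_sum hD)).trans ?_
  rw [Finset.sum_add_distrib, ← Finset.mul_sum, ← Finset.mul_sum, add_mul]
  refine add_le_add ?_ ?_
  · refine mul_le_mul_of_nonneg_left ?_ (by positivity)
    rw [← Finset.sum_filter, ← hlS]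
    refine Finset.sum_le_sum_of_subset_of_nonneg (fun D hD => ?_) fun _ _ _ => by positivity
    rw [Finset.mem_filter, mem_sqfreeLE] at hD
    exact mem_sqfreeDeg.2 ⟨⟨hD.1.1, hD.2⟩, hD.1.2.2⟩
  · have hPs : ∑ D ∈ sqfreeLE F n, P D ≤ Y * S := by
      rw [← hlS]
      refine le_trans (Finset.sum_le_sum fun D hD => ?_)
        (sum_sum_dvd_le le_rfl hY (fun N => ‖l N‖ ^ 2) fun N => by positivity)
      obtain ⟨hDm, hDn, hDs⟩ := mem_sqfreeLE.1 hD
      simp only [hP]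
      rw [← Finset.sum_filter]
      have h3 : ∑ A ∈ sqfreeDeg F (n - D.natDegree), ‖l (D * A)‖ ^ 2 =
          ∑ N ∈ (sqfreeDeg F (n - D.natDegree)).image (D * ·), ‖l N‖ ^ 2 := by
        rw [Finset.sum_image]
        intro A _ B _ h
        exact mul_left_cancel₀ hDm.ne_zero h
      rw [h3, ← Finset.sum_filter_add_sum_filter_not _ (fun N => N ∈ sqfreeDeg F n)]
      have h4 : ∑ N ∈ ((sqfreeDeg F (n - D.natDegree)).image (D * ·)).filter
          (fun N => ¬ N ∈ sqfreeDeg F n), ‖l N‖ ^ 2 = 0 := by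
        refine Finset.sum_eq_zero fun N hN => ?_
        simp only [hl, if_neg (Finset.mem_filter.1 hN).2]
        simp
      rw [h4, add_zero]
      refine Finset.sum_le_sum_of_subset_of_nonneg (fun N hN => ?_) fun _ _ _ => by positivity
      rw [Finset.mem_filter, Finset.mem_image] at hN
      obtain ⟨⟨A, -, rfl⟩, hN⟩ := hN
      exact Finset.mem_filter.2 ⟨hN, dvd_mul_right _ _⟩
    calc Y ^ 2 * (q * (2 * n)) * Z * ∑ D ∈ sqfreeLE F n, P D
        ≤ Y ^ 2 * (q * (2 * n)) * Z * (Y * S) := mul_le_mul_of_nonneg_left hPs (by positivity)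
      _ = _ := by ring

/-- In the range `m ≥ 2 n` distinct characters are orthogonal. -/
lemma sieveBound_of_two_mul_le (hχ : χ ≠ 1) (hneg : χ (-1) = 1) {m n : ℕ} (h : 2 * n ≤ m) :
    SieveBound χ (monicDeg F m) n ((Fintype.card F : ℝ) ^ m) := by
  classical
  have := sieveBound_of_poisson (m := m) (n := n)
    (Y := ((sqfreeLE F n).card : ℝ)) (Z := 0) hχ hneg le_rfl
    (fun D _ => by exact_mod_cast Finset.card_le_card (Finset.filter_subset _ _))
    (fun a k j _ _ _ _ _ => by omega)
  simpa using this

end PoissonBound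

/-! ### From square-free to arbitrary outer variables -/

section CubeDecomposition

variable {F : Type*} [Field F]

/-- Every monic polynomial is `A * B ^ 2 * D ^ 3` with `A`, `B` square-free: extract cubes of primes as
long as possible, then squares. -/
lemma exists_eq_mul_sq_mul_cube {M : F[X]} (hM : M.Monic) :
    ∃ A B D : F[X], A.Monic ∧ B.Monic ∧ D.Monic ∧ Squarefree A ∧ Squarefree B ∧
      A * B ^ 2 * D ^ 3 = M := by
  induction h : M.natDegree using Nat.strong_induction_on generalizing M with
  | _ d ih =>
    have hstep : ∀ P : F[X], P.Monic → Irreducible P → ∀ r, 1 ≤ r → P ^ r ∣ M →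
        ∃ M', M'.Monic ∧ M'.natDegree < d ∧ M = P ^ r * M' := by
      intro P hP hirr r hr hd
      obtain ⟨M', hM'⟩ := hd
      have hm : M'.Monic := (hP.pow r).of_mul_monic_left (hM' ▸ hM)
      refine ⟨M', hm, ?_, hM'⟩
      have h1 := (hP.pow r).natDegree_mul hm
      rw [← hM', h, natDegree_pow] at h1
      have := Nat.mul_pos hr hirr.natDegree_pos
      omega
    by_cases h3 : ∃ P : F[X], P.Monic ∧ Irreducible P ∧ P ^ 3 ∣ M
    · obtain ⟨P, hP, hirr, hd⟩ := h3
      obtain ⟨M', hm, hlt, rfl⟩ := hstep P hP hirr 3 (by norm_num) hd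
      obtain ⟨A, B, D, hA, hB, hD, hAs, hBs, he⟩ := ih _ hlt hm rfl
      exact ⟨A, B, P * D, hA, hB, hP.mul hD, hAs, hBs, by rw [← he]; ring⟩
    · by_cases h2 : ∃ P : F[X], P.Monic ∧ Irreducible P ∧ P ^ 2 ∣ M
      · obtain ⟨P, hP, hirr, hd⟩ := h2
        obtain ⟨M', hm, hlt, rfl⟩ := hstep P hP hirr 2 (by norm_num) hd
        obtain ⟨A, B, D, hA, hB, hD, hAs, hBs, he⟩ := ih _ hlt hm rfl
        have hPB : ¬ P ∣ B := by
          rintro ⟨B', rfl⟩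
          exact h3 ⟨P, hP, hirr, ⟨P * A * B' ^ 2 * D ^ 3, by rw [← he]; ring⟩⟩
        refine ⟨A, P * B, D, hA, hP.mul hB, hD, hAs, ?_, by rw [← he]; ring⟩
        rw [squarefree_mul_iff]
        exact ⟨(hirr.coprime_iff_not_dvd.2 hPB).isRelPrime, hirr.squarefree, hBs⟩
      · refine ⟨M, 1, 1, hM, monic_one, monic_one, ?_, squarefree_one, by ring⟩
        rw [squarefree_iff_irreducible_sq_not_dvd_of_ne_zero hM.ne_zero]
        intro x hx hd
        classical
        refine h2 ⟨normalize x, monic_normalize hx.ne_zero,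
          (associated_normalize x).irreducible hx, ?_⟩
        rw [sq]
        exact ((normalize_associated x).mul_mul (normalize_associated x)).dvd.trans hd

variable [Fintype F] {χ : MulChar F ℂ}

/-- From square-free to arbitrary outer variables: writing `M = A * B ^ 2 * D ^ 3`, either `A` or `B`
is kept as the variable, where `B` carries the symbol attached to `χ ^ 2`. -/
theorem sieveBound_monicDeg_of_sqfree {m n : ℕ} {Z : ℝ} (hZ : 0 ≤ Z)
    (H : ∀ a b d, a + 2 * b + 3 * d = m →
      SieveBound χ (sqfreeDeg F a) n (Z / (Fintype.card F : ℝ) ^ (b + d)) ∨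
      SieveBound (χ ^ 2) (sqfreeDeg F b) n (Z / (Fintype.card F : ℝ) ^ (a + d))) :
    SieveBound χ (monicDeg F m) n (((m : ℝ) + 1) ^ 3 * Z) := by
  classical
  intro lam
  set q : ℝ := (Fintype.card F : ℝ) with hq
  have hq0 : 0 < q := by rw [hq]; exact_mod_cast Fintype.card_pos
  set S := ∑ N ∈ sqfreeDeg F n, ‖lam N‖ ^ 2 with hS
  have hS0 : 0 ≤ S := Finset.sum_nonneg fun _ _ => by positivity
  set g : F[X] → ℝ := fun M => ‖∑ N ∈ sqfreeDeg F n, lam N * symb χ N M‖ ^ 2 with hg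
  have hg0 : ∀ M, 0 ≤ g M := fun M => by positivity
  let R := Finset.range (m + 1)
  let T : Finset (ℕ × ℕ × ℕ) := (R ×ˢ R ×ˢ R).filter fun t => t.1 + 2 * t.2.1 + 3 * t.2.2 = m
  have hTc : (T.card : ℝ) ≤ ((m : ℝ) + 1) ^ 3 := by
    have : T.card ≤ (m + 1) ^ 3 := by
      refine (Finset.card_filter_le _ _).trans (le_of_eq ?_)
      simp only [R, Finset.card_product, Finset.card_range]
      ring
    exact_mod_cast this
  let V : ℕ × ℕ × ℕ → Finset (F[X] × F[X] × F[X]) := fun t =>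
    sqfreeDeg F t.1 ×ˢ sqfreeDeg F t.2.1 ×ˢ monicDeg F t.2.2
  let f : F[X] × F[X] × F[X] → F[X] := fun x => x.1 * x.2.1 ^ 2 * x.2.2 ^ 3
  have hcover : monicDeg F m ⊆ (T.sigma V).image fun s => f s.2 := by
    intro M hM
    obtain ⟨h1, h2⟩ := mem_monicDeg.1 hM
    obtain ⟨A, B, D, hA, hB, hD, hAs, hBs, he⟩ := exists_eq_mul_sq_mul_cube h1
    have hdeg : A.natDegree + 2 * B.natDegree + 3 * D.natDegree = m := by
      rw [← h2, ← he, (hA.mul (hB.pow 2)).natDegree_mul (hD.pow 3), hA.natDegree_mul (hB.pow 2),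
        natDegree_pow, natDegree_pow]
    refine Finset.mem_image.2 ⟨⟨(A.natDegree, B.natDegree, D.natDegree), (A, B, D)⟩,
      Finset.mem_sigma.2 ⟨?_, ?_⟩, he⟩
    · simp only [T, R, Finset.mem_filter, Finset.mem_product, Finset.mem_range]
      exact ⟨⟨by omega, by omega, by omega⟩, hdeg⟩
    · simp only [V, Finset.mem_product, mem_sqfreeDeg, mem_monicDeg]
      exact ⟨⟨⟨hA, trivial⟩, hAs⟩, ⟨⟨hB, trivial⟩, hBs⟩, ⟨hD, trivial⟩⟩
  have h1 : ∑ M ∈ monicDeg F m, g M ≤ ∑ t ∈ T, ∑ x ∈ V t, g (f x) := by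
    refine (Finset.sum_le_sum_of_subset_of_nonneg hcover fun M _ _ => hg0 M).trans ?_
    refine (Finset.sum_image_le_of_nonneg fun M _ => hg0 M).trans (le_of_eq ?_)
    rw [Finset.sum_sigma]
  have hcs : ∀ d, ((sqfreeDeg F d).card : ℝ) ≤ q ^ d := by
    intro d
    have := Finset.card_le_card (sqfreeDeg_subset (F := F) d)
    rw [card_monicDeg] at this
    rw [hq]; exact_mod_cast this
  have hcm : ∀ d, ((monicDeg F d).card : ℝ) = q ^ d := by
    intro d
    rw [card_monicDeg, hq]; push_cast; rfl
  have hsy : ∀ N ∈ sqfreeDeg F n, ∀ M, ‖symb χ N M‖ ≤ 1 := fun N hN M =>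
    norm_symb_le_one (mem_sqfreeDeg.1 hN).1.1
  have h2 : ∀ t ∈ T, ∑ x ∈ V t, g (f x) ≤ Z * S := by
    rintro ⟨a, b, d⟩ ht
    have hm : a + 2 * b + 3 * d = m := (Finset.mem_filter.1 ht).2
    simp only [V]
    rcases H a b d hm with h | h
    · rw [Finset.sum_product_right]
      have h3 : ∀ y ∈ sqfreeDeg F b ×ˢ monicDeg F d, ∑ A ∈ sqfreeDeg F a, g (f (A, y)) ≤
          Z / q ^ (b + d) * S := by
        rintro ⟨B, D⟩ _
        have h4 := h fun N => lam N * symb χ N B ^ 2 * symb χ N D ^ 3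
        refine le_trans (le_of_eq ?_) (h4.trans ?_)
        · refine Finset.sum_congr rfl fun A _ => ?_
          simp only [hg, f]
          congr 2
          refine Finset.sum_congr rfl fun N hN => ?_
          have hN := (mem_sqfreeDeg.1 hN).1.1
          rw [symb_mul_right hN, symb_mul_right hN, symb_pow_right hN, symb_pow_right hN]
          ring
        · refine mul_le_mul_of_nonneg_left (Finset.sum_le_sum fun N hN => ?_) (by positivity)
          refine pow_le_pow_left₀ (norm_nonneg _) ?_ 2
          rw [norm_mul, norm_mul, norm_pow, norm_pow, mul_assoc]
          exact mul_le_of_le_one_right (norm_nonneg _) (mul_le_one₀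
            (pow_le_one₀ (norm_nonneg _) (hsy N hN B)) (by positivity)
            (pow_le_one₀ (norm_nonneg _) (hsy N hN D)))
      refine (Finset.sum_le_sum h3).trans ?_
      rw [Finset.sum_const, nsmul_eq_mul, Finset.card_product, Nat.cast_mul, hcm]
      calc ((sqfreeDeg F b).card : ℝ) * q ^ d * (Z / q ^ (b + d) * S)
          ≤ q ^ b * q ^ d * (Z / q ^ (b + d) * S) := by
            gcongr
            exact hcs b
        _ = Z * S := by rw [pow_add]; field_simp
    · rw [Finset.sum_product]
      have h3 : ∀ A ∈ sqfreeDeg F a, ∑ y ∈ sqfreeDeg F b ×ˢ monicDeg F d, g (f (A, y)) ≤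
          q ^ d * (Z / q ^ (a + d) * S) := by
        intro A _
        rw [Finset.sum_product_right, ← hcm, ← nsmul_eq_mul, ← Finset.sum_const]
        refine Finset.sum_le_sum fun D _ => ?_
        have h4 := h fun N => lam N * symb χ N A * symb χ N D ^ 3
        refine le_trans (le_of_eq ?_) (h4.trans ?_)
        · refine Finset.sum_congr rfl fun B _ => ?_
          simp only [hg, f]
          congr 2
          refine Finset.sum_congr rfl fun N hN => ?_
          have hN := (mem_sqfreeDeg.1 hN).1.1
          rw [symb_mul_right hN, symb_mul_right hN, symb_pow_right hN, symb_pow_right hN, symb_sq]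
          ring
        · refine mul_le_mul_of_nonneg_left (Finset.sum_le_sum fun N hN => ?_) (by positivity)
          refine pow_le_pow_left₀ (norm_nonneg _) ?_ 2
          rw [norm_mul, norm_mul, norm_pow, mul_assoc]
          exact mul_le_of_le_one_right (norm_nonneg _) (mul_le_one₀
            (hsy N hN A) (by positivity) (pow_le_one₀ (norm_nonneg _) (hsy N hN D)))
      refine (Finset.sum_le_sum h3).trans ?_
      rw [Finset.sum_const, nsmul_eq_mul]
      calc ((sqfreeDeg F a).card : ℝ) * (q ^ d * (Z / q ^ (a + d) * S))
          ≤ q ^ a * (q ^ d * (Z / q ^ (a + d) * S)) := by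
            gcongr
            exact hcs a
        _ = Z * S := by rw [pow_add]; field_simp
  calc ∑ M ∈ monicDeg F m, g M ≤ ∑ t ∈ T, Z * S := h1.trans (Finset.sum_le_sum h2)
    _ = T.card * (Z * S) := by rw [Finset.sum_const, nsmul_eq_mul]
    _ ≤ ((m : ℝ) + 1) ^ 3 * (Z * S) := by gcongr
    _ = _ := by ring

end CubeDecomposition

/-! ### Lengthening the outer sum -/

section Lengthening

variable {F : Type*} [Field F] [Fintype F] {χ : MulChar F ℂ}

open scoped Classical in
/-- The monic irreducible polynomials whose degree divides `y`, as the prime factors of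
`t ^ (q ^ y) - t`. -/
noncomputable def irredDvd (F : Type*) [Field F] [Fintype F] (y : ℕ) : Finset F[X] :=
  (UniqueFactorizationMonoid.normalizedFactors
    (X ^ Fintype.card F ^ y - X : F[X])).toFinset

lemma monic_X_pow_sub_X {y : ℕ} (hy : y ≠ 0) : (X ^ Fintype.card F ^ y - X : F[X]).Monic :=
  monic_X_pow_sub (by
    rw [degree_X]
    exact_mod_cast Nat.one_lt_pow hy Fintype.one_lt_card)

lemma mem_irredDvd {y : ℕ} (hy : y ≠ 0) {P : F[X]} (hP : P ∈ irredDvd F y) :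
    P.Monic ∧ Irreducible P ∧ P.natDegree ∣ y := by
  classical
  rw [irredDvd, Multiset.mem_toFinset,
    Polynomial.mem_normalizedFactors_iff (monic_X_pow_sub_X hy).ne_zero] at hP
  refine ⟨hP.2.1, hP.1, hP.1.natDegree_dvd_of_dvd_X_pow_card_pow_sub_X ?_⟩
  rw [Nat.card_eq_fintype_card]
  exact hP.2.2

lemma prod_irredDvd {y : ℕ} (hy : y ≠ 0) :
    ∏ P ∈ irredDvd F y, P = X ^ Fintype.card F ^ y - X := by
  classical
  have hm := monic_X_pow_sub_X (F := F) hy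
  have hsep : (X ^ Fintype.card F ^ y - X : F[X]).Separable := by
    obtain ⟨p, hp⟩ := CharP.exists F
    refine galois_poly_separable p _ (dvd_pow ?_ hy)
    exact (CharP.cast_eq_zero_iff F p _).1 (FiniteField.cast_card_eq_zero F)
  have hsq := hsep.squarefree
  rw [irredDvd, Finset.prod_eq_multiset_prod, Multiset.map_id', Multiset.toFinset_val,
    Multiset.dedup_eq_self.2
      ((UniqueFactorizationMonoid.squarefree_iff_nodup_normalizedFactors hm.ne_zero).1 hsq),
    UniqueFactorizationMonoid.prod_normalizedFactors_eq hm.ne_zero, hm.normalize_eq_self]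

lemma natDegree_X_pow_sub_X {y : ℕ} (hy : y ≠ 0) :
    (X ^ Fintype.card F ^ y - X : F[X]).natDegree = Fintype.card F ^ y :=
  FiniteField.X_pow_card_pow_sub_X_natDegree_eq F hy Fintype.one_lt_card

lemma card_irredDvd_le {y : ℕ} (hy : y ≠ 0) : (irredDvd F y).card ≤ Fintype.card F ^ y := by
  rw [← natDegree_X_pow_sub_X hy, ← prod_irredDvd hy,
    natDegree_prod_of_monic _ _ fun P hP => (mem_irredDvd hy hP).1, Finset.card_eq_sum_ones]
  exact Finset.sum_le_sum fun P hP => (mem_irredDvd hy hP).2.1.natDegree_pos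

/-- A nonzero polynomial of degree less than `q ^ y` is not divisible by all the irreducibles of degree
dividing `y`, because their product has degree `q ^ y`. -/
lemma exists_irredDvd_not_dvd {y : ℕ} (hy : y ≠ 0) {N : F[X]} (hN : N ≠ 0)
    (h : N.natDegree < Fintype.card F ^ y) : ∃ P ∈ irredDvd F y, ¬ P ∣ N := by
  by_contra! hc
  have : ∏ P ∈ irredDvd F y, P ∣ N := by
    refine Finset.prod_dvd_of_coprime ?_ hc
    intro P hP Q hQ hPQ
    obtain ⟨h1, h2, -⟩ := mem_irredDvd hy hP
    obtain ⟨h3, h4, -⟩ := mem_irredDvd hy hQ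
    refine h2.coprime_iff_not_dvd.2 fun hd => hPQ ?_
    exact eq_of_monic_of_associated h1 h3 (h2.associated_of_dvd h4 hd)
  rw [prod_irredDvd hy] at this
  have h5 := natDegree_le_of_dvd this hN
  rw [natDegree_X_pow_sub_X hy] at h5
  omega

/-- The large sieve constant is essentially increasing in the length of the outer sum: multiply `M`
by a power of degree `x` of an irreducible not dividing `N`. Sorting the `N` by this irreducible costs
only the factor `q ^ y`, which can be taken to be `O(n + 1)`. -/
theorem sieveBound_of_add {m n x y : ℕ} (hy : y ≠ 0) (hn : n < Fintype.card F ^ y) (hyx : y ∣ x)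
    {X : ℝ} (h : SieveBound χ (monicDeg F (m + x)) n X) :
    SieveBound χ (sqfreeDeg F m) n ((Fintype.card F : ℝ) ^ y * X) := by
  classical
  intro lam
  have hex : ∀ N : F[X], ∃ P ∈ irredDvd F y, N ∈ sqfreeDeg F n → ¬ P ∣ N := by
    intro N
    by_cases hN : N ∈ sqfreeDeg F n
    · obtain ⟨⟨h1, h2⟩, -⟩ := mem_sqfreeDeg.1 hN
      obtain ⟨P, hP, hd⟩ := exists_irredDvd_not_dvd hy h1.ne_zero (by rwa [h2])
      exact ⟨P, hP, fun _ => hd⟩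
    · obtain ⟨P, hP, -⟩ := exists_irredDvd_not_dvd (F := F) hy one_ne_zero
        (by rw [natDegree_one]; omega)
      exact ⟨P, hP, fun h => absurd h hN⟩
  choose p hp hpd using hex
  set q : ℝ := (Fintype.card F : ℝ) with hq
  let R : F[X] → F[X] := fun P => P ^ (x / P.natDegree)
  have hRm : ∀ P ∈ irredDvd F y, R P ∈ monicDeg F x := by
    intro P hP
    obtain ⟨h1, -, h3⟩ := mem_irredDvd hy hP
    rw [mem_monicDeg]
    refine ⟨h1.pow _, ?_⟩
    simp only [R]
    rw [natDegree_pow, Nat.div_mul_cancel (h3.trans hyx)]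
  let c : F[X] → F[X] → ℂ := fun P N => if p N = P then lam N * conj (symb χ N (R P)) else 0
  have h1 : ∀ M, ‖∑ N ∈ sqfreeDeg F n, lam N * symb χ N M‖ ^ 2 ≤
      q ^ y * ∑ P ∈ irredDvd F y, ‖∑ N ∈ sqfreeDeg F n, c P N * symb χ N (M * R P)‖ ^ 2 := by
    intro M
    have h2 : ∑ N ∈ sqfreeDeg F n, lam N * symb χ N M =
        ∑ P ∈ irredDvd F y, ∑ N ∈ sqfreeDeg F n, c P N * symb χ N (M * R P) := by
      rw [Finset.sum_comm]
      refine Finset.sum_congr rfl fun N hN => ?_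
      rw [Finset.sum_eq_single_of_mem (p N) (hp N)]
      · have hNm := (mem_sqfreeDeg.1 hN).1.1
        have hcop : IsCoprime N (R (p N)) :=
          (((mem_irredDvd hy (hp N)).2.1.coprime_iff_not_dvd.2 (hpd N hN)).symm).pow_right
        simp only [c, if_true]
        rw [symb_mul_right hNm]
        linear_combination (-(lam N * symb χ N M)) * symb_mul_conj (χ := χ) hNm hcop
      · intro P _ hPN
        simp [c, Ne.symm hPN]
    rw [h2]
    calc _ ≤ (∑ P ∈ irredDvd F y, ‖∑ N ∈ sqfreeDeg F n, c P N * symb χ N (M * R P)‖) ^ 2 :=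
          pow_le_pow_left₀ (norm_nonneg _) (norm_sum_le _ _) 2
      _ ≤ _ := sq_sum_le_card_mul_sum_sq
      _ ≤ _ := by
          refine mul_le_mul_of_nonneg_right ?_ (Finset.sum_nonneg fun _ _ => by positivity)
          rw [hq]; exact_mod_cast card_irredDvd_le hy
  have h3 : ∀ P ∈ irredDvd F y,
      ∑ M ∈ sqfreeDeg F m, ‖∑ N ∈ sqfreeDeg F n, c P N * symb χ N (M * R P)‖ ^ 2 ≤
        X * ∑ N ∈ sqfreeDeg F n, ‖c P N‖ ^ 2 := by
    intro P hP
    obtain ⟨hR1, hR2⟩ := mem_monicDeg.1 (hRm P hP)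
    refine le_trans ?_ (h (c P))
    rw [← Finset.sum_image (s := sqfreeDeg F m) (g := fun M => M * R P)
      (f := fun M => ‖∑ N ∈ sqfreeDeg F n, c P N * symb χ N M‖ ^ 2)
      (fun A _ B _ hAB => mul_right_cancel₀ hR1.ne_zero hAB)]
    refine Finset.sum_le_sum_of_subset_of_nonneg (fun M hM => ?_) fun _ _ _ => by positivity
    obtain ⟨A, hA, rfl⟩ := Finset.mem_image.1 hM
    obtain ⟨⟨hA1, hA2⟩, -⟩ := mem_sqfreeDeg.1 hA
    exact mem_monicDeg.2 ⟨hA1.mul hR1, by rw [hA1.natDegree_mul hR1, hA2, hR2]⟩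
  have h4 : ∑ P ∈ irredDvd F y, ∑ N ∈ sqfreeDeg F n, ‖c P N‖ ^ 2 =
      ∑ N ∈ sqfreeDeg F n, ‖lam N‖ ^ 2 := by
    rw [Finset.sum_comm]
    refine Finset.sum_congr rfl fun N hN => ?_
    rw [Finset.sum_eq_single_of_mem (p N) (hp N)]
    · have hNm := (mem_sqfreeDeg.1 hN).1.1
      have hcop : IsCoprime N (R (p N)) :=
        (((mem_irredDvd hy (hp N)).2.1.coprime_iff_not_dvd.2 (hpd N hN)).symm).pow_right
      simp only [c, if_true]
      rw [norm_mul, RCLike.norm_conj, norm_symb_of_isCoprime hNm hcop, mul_one]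
    · intro P _ hPN
      simp [c, Ne.symm hPN]
  calc ∑ M ∈ sqfreeDeg F m, ‖∑ N ∈ sqfreeDeg F n, lam N * symb χ N M‖ ^ 2
      ≤ ∑ M ∈ sqfreeDeg F m, q ^ y *
          ∑ P ∈ irredDvd F y, ‖∑ N ∈ sqfreeDeg F n, c P N * symb χ N (M * R P)‖ ^ 2 :=
        Finset.sum_le_sum fun M _ => h1 M
    _ = q ^ y * ∑ P ∈ irredDvd F y,
          ∑ M ∈ sqfreeDeg F m, ‖∑ N ∈ sqfreeDeg F n, c P N * symb χ N (M * R P)‖ ^ 2 := by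
        rw [← Finset.mul_sum, Finset.sum_comm]
    _ ≤ q ^ y * ∑ P ∈ irredDvd F y, X * ∑ N ∈ sqfreeDeg F n, ‖c P N‖ ^ 2 :=
        mul_le_mul_of_nonneg_left (Finset.sum_le_sum h3) (by positivity)
    _ = q ^ y * X * ∑ N ∈ sqfreeDeg F n, ‖lam N‖ ^ 2 := by
        rw [← Finset.mul_sum, h4, mul_assoc]

end Lengthening

/-! ### Iteration of the recursive inequality -/

section Iteration

variable {F : Type*} [Field F] [Fintype F] {χ : MulChar F ℂ}

/-- Polynomial factors are absorbed by arbitrarily small powers. -/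
lemma exists_pow_le_rpow {q : ℝ} (hq : 1 < q) (c : ℕ) {δ : ℝ} (hδ : 0 < δ) :
    ∃ K : ℝ, 1 ≤ K ∧ ∀ n : ℕ, ((n : ℝ) + 1) ^ c ≤ K * q ^ (δ * n) := by
  set t : ℝ := δ / (c + 1) * Real.log q with ht
  have ht0 : 0 < t := mul_pos (by positivity) (Real.log_pos hq)
  refine ⟨(1 + 1 / t) ^ c, one_le_pow₀ (by have : 0 < 1 / t := by positivity
                                           linarith), fun n => ?_⟩
  have hq0 : 0 < q := by linarith
  have h1 : (n : ℝ) + 1 ≤ (1 + 1 / t) * q ^ (δ / (c + 1) * n) := by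
    have h2 : 1 + t * n ≤ q ^ (δ / (c + 1) * n) := by
      rw [Real.rpow_def_of_pos hq0, show Real.log q * (δ / (c + 1) * n) = t * n by rw [ht]; ring]
      linarith [Real.add_one_le_exp (t * n)]
    have h3 : (n : ℝ) + 1 ≤ (1 + 1 / t) * (1 + t * n) := by
      have : (1 + 1 / t) * (1 + t * n) = n + 1 + (t * n + 1 / t) := by field_simp; ring
      rw [this]
      have : 0 ≤ t * n + 1 / t := by positivity
      linarith
    exact h3.trans (mul_le_mul_of_nonneg_left h2 (by positivity))
  calc ((n : ℝ) + 1) ^ c ≤ ((1 + 1 / t) * q ^ (δ / (c + 1) * n)) ^ c :=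
        pow_le_pow_left₀ (by positivity) h1 c
    _ = (1 + 1 / t) ^ c * q ^ (δ / (c + 1) * n * c) := by
        rw [mul_pow, ← Real.rpow_natCast (q ^ _), ← Real.rpow_mul hq0.le]
    _ ≤ _ := by
        refine mul_le_mul_of_nonneg_left (Real.rpow_le_rpow_of_exponent_le hq.le ?_) (by positivity)
        have : δ / (c + 1) * n * c = δ * n * (c / (c + 1)) := by ring
        rw [this]
        refine mul_le_of_le_one_right (by positivity) ?_
        rw [div_le_one (by positivity)]
        linarith

/-- The exponent `max (m, n, 2 (m + n) / 3, (4 / 3 + η) min (m, n))`. -/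
noncomputable def sqfreeExponent (η m n : ℝ) : ℝ :=
  max (max m n) (max (2 * (m + n) / 3) ((4 / 3 + η) * min m n))

/-- The large sieve bound with both variables square-free, with excess `η` over the exponent `4 / 3` on
the diagonal `m = n`. -/
def SqfreeLargeSieve (χ : MulChar F ℂ) (η : ℝ) : Prop :=
  ∀ ε : ℝ, 0 < ε → ∃ K : ℝ, 1 ≤ K ∧ ∀ m n : ℕ, SieveBound χ (sqfreeDeg F m) n
    (K * (Fintype.card F : ℝ) ^ (ε * (m + n) + sqfreeExponent η m n))

/-- The large sieve bound for an outer sum over all monic polynomials of degree `m ≤ n`, with the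
exponent obtained from `SqfreeLargeSieve χ η`. -/
def ShortLargeSieve (χ : MulChar F ℂ) (η : ℝ) : Prop :=
  ∀ ε : ℝ, 0 < ε → ∃ K : ℝ, 1 ≤ K ∧ ∀ m n : ℕ, m ≤ n → SieveBound χ (monicDeg F m) n
    (K * (Fintype.card F : ℝ) ^ (ε * (m + n) + max ((n : ℝ) + m / 3) ((4 / 3 + η) * m)))

/-- The large sieve bound for an outer sum over all monic polynomials of degree `m ≥ n`, with the
exponent obtained from `ShortLargeSieve χ η` by Poisson summation. -/
def LongLargeSieve (χ : MulChar F ℂ) (η : ℝ) : Prop :=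
  ∀ ε : ℝ, 0 < ε → ∃ K : ℝ, 1 ≤ K ∧ ∀ m n : ℕ, n ≤ m → SieveBound χ (monicDeg F m) n
    (K * (Fintype.card F : ℝ) ^ (ε * (m + n) +
      max (max (m : ℝ) (2 * (m + n) / 3)) ((5 / 3 + 2 * η) * n - (1 / 3 + η) * m)))

lemma one_lt_card_real (F : Type*) [Field F] [Fintype F] : (1 : ℝ) < Fintype.card F := by
  exact_mod_cast Fintype.one_lt_card

/-- The initial bound: orthogonality if one of `m`, `n` is at least twice the other, and otherwise
the Cauchy–Schwarz inequality, as then `m + n ≤ 3 * min (m, n)`. -/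
lemma sqfreeLargeSieve_base (hχ : χ ≠ 1) (hneg : χ (-1) = 1) : SqfreeLargeSieve χ (5 / 3) := by
  intro ε hε
  refine ⟨1, le_rfl, fun m n => ?_⟩
  set q : ℝ := (Fintype.card F : ℝ) with hq
  have hq1 : 1 < q := one_lt_card_real F
  have hm0 : (0 : ℝ) ≤ m := Nat.cast_nonneg m
  have hn0 : (0 : ℝ) ≤ n := Nat.cast_nonneg n
  have hE : 0 ≤ ε * ((m : ℝ) + n) := by positivity
  have key : ∀ k : ℕ, (k : ℝ) ≤ sqfreeExponent (5 / 3) m n →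
      q ^ k ≤ 1 * q ^ (ε * ((m : ℝ) + n) + sqfreeExponent (5 / 3) m n) := by
    intro k hk
    rw [one_mul, ← Real.rpow_natCast]
    exact Real.rpow_le_rpow_of_exponent_le hq1.le (by linarith)
  by_cases h1 : 2 * n ≤ m
  · exact ((sieveBound_of_two_mul_le hχ hneg h1).subset (sqfreeDeg_subset m)).mono
      (key m ((le_max_left _ _).trans (le_max_left _ _)))
  by_cases h2 : 2 * m ≤ n
  · exact (((sieveBound_of_two_mul_le hχ hneg h2).subset (sqfreeDeg_subset n)).swap hneg
      (by positivity)).mono (key n ((le_max_right _ _).trans (le_max_left _ _)))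
  · refine ((sieveBound_trivial χ m n).subset (sqfreeDeg_subset m)).mono (key (m + n) ?_)
    refine le_trans ?_ ((le_max_right _ _).trans (le_max_right _ _))
    have h3 : (m : ℝ) ≤ 2 * n := by exact_mod_cast (by omega : m ≤ 2 * n)
    have h4 : (n : ℝ) ≤ 2 * m := by exact_mod_cast (by omega : n ≤ 2 * m)
    push_cast
    rcases le_total (m : ℝ) n with h | h
    · rw [min_eq_left h]; linarith
    · rw [min_eq_right h]; linarith

/-- Passing to all monic outer variables. In `M = A * B ^ 2 * D ^ 3` the larger of `A`, `B` is kept;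
if it is `B` then `deg B ≤ n / 2` and the characters attached to `χ ^ 2` are orthogonal. -/
lemma SqfreeLargeSieve.short {η : ℝ} (hη : 0 ≤ η) (hχ2 : χ ^ 2 ≠ 1) (hneg : χ (-1) = 1)
    (h : SqfreeLargeSieve χ η) : ShortLargeSieve χ η := by
  intro ε hε
  set q : ℝ := (Fintype.card F : ℝ) with hq
  have hq1 : 1 < q := one_lt_card_real F
  have hq0 : 0 < q := by linarith
  obtain ⟨K₁, hK₁, h₁⟩ := h (ε / 2) (by positivity)
  obtain ⟨K₂, hK₂, h₂⟩ := exists_pow_le_rpow hq1 3 (half_pos hε)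
  refine ⟨K₂ * K₁, by nlinarith, fun m n hmn => ?_⟩
  set e : ℝ := max ((n : ℝ) + m / 3) ((4 / 3 + η) * m) with he
  have he1 : (n : ℝ) + m / 3 ≤ e := le_max_left _ _
  have he2 : (4 / 3 + η) * m ≤ e := le_max_right _ _
  have hmn' : (m : ℝ) ≤ n := by exact_mod_cast hmn
  set Z : ℝ := K₁ * q ^ (ε / 2 * ((m : ℝ) + n) + e) with hZ
  have hZ0 : 0 ≤ Z := by positivity
  have hmain := sieveBound_monicDeg_of_sqfree (χ := χ) (m := m) (n := n) hZ0 (by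
    intro a b d habd
    have habd' : (a : ℝ) + 2 * b + 3 * d = m := by exact_mod_cast habd
    have ha0 : (0 : ℝ) ≤ a := Nat.cast_nonneg a
    have hb0 : (0 : ℝ) ≤ b := Nat.cast_nonneg b
    have hd0 : (0 : ℝ) ≤ d := Nat.cast_nonneg d
    rcases le_or_gt b a with hba | hab
    · left
      have hba' : (b : ℝ) ≤ a := by exact_mod_cast hba
      refine (h₁ a n).mono ?_
      rw [le_div_iff₀ (by positivity), ← hq, ← Real.rpow_natCast, mul_assoc, ← Real.rpow_add hq0,
        hZ]
      refine mul_le_mul_of_nonneg_left (Real.rpow_le_rpow_of_exponent_le hq1.le ?_) (by positivity)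
      have hε2 : ε / 2 * ((a : ℝ) + n) ≤ ε / 2 * ((m : ℝ) + n) :=
        mul_le_mul_of_nonneg_left (by linarith) (by positivity)
      have hE : sqfreeExponent η a n + (b + d) ≤ e := by
        rw [← le_sub_iff_add_le, sqfreeExponent, min_eq_left (by linarith)]
        refine max_le (max_le (by linarith) (by linarith)) (max_le (by linarith) ?_)
        have : (4 / 3 + η) * (a + 2 * b + 3 * d) ≤ e := by rw [habd']; exact he2
        nlinarith [mul_nonneg hη hb0, mul_nonneg hη hd0]
      push_cast
      linarith
    · right
      have hab' : (a : ℝ) ≤ b := by exact_mod_cast hab.le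
      have hneg2 : (χ ^ 2) (-1) = 1 := by rw [MulChar.pow_apply' _ two_ne_zero, hneg, one_pow]
      refine (((sieveBound_of_two_mul_le hχ2 hneg2 (m := n) (n := b) (by omega)).subset
        (sqfreeDeg_subset n)).swap hneg2 (by positivity)).mono ?_
      rw [le_div_iff₀ (by positivity), ← hq, ← pow_add, ← Real.rpow_natCast, hZ,
        ← one_mul (q ^ ((n + (a + d) : ℕ) : ℝ))]
      refine mul_le_mul hK₁ (Real.rpow_le_rpow_of_exponent_le hq1.le ?_) (by positivity)
        (by positivity)
      have : 0 ≤ ε / 2 * ((m : ℝ) + n) := by positivity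
      push_cast
      linarith)
  refine hmain.mono ?_
  calc ((m : ℝ) + 1) ^ 3 * Z ≤ (K₂ * q ^ (ε / 2 * m)) * Z :=
        mul_le_mul_of_nonneg_right (h₂ m) hZ0
    _ = K₂ * K₁ * q ^ (ε / 2 * m + (ε / 2 * ((m : ℝ) + n) + e)) := by
        rw [hZ, Real.rpow_add hq0 (ε / 2 * m)]; ring
    _ ≤ _ := by
        refine mul_le_mul_of_nonneg_left (Real.rpow_le_rpow_of_exponent_le hq1.le ?_)
          (by positivity)
        have : 0 ≤ ε / 2 * (n : ℝ) := by positivity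
        linarith

/-- Poisson summation turns a long outer sum into short ones. -/
lemma ShortLargeSieve.long {η : ℝ} (hη : 0 ≤ η) (hχ : χ ≠ 1) (hneg : χ (-1) = 1)
    (h : ShortLargeSieve χ η) : LongLargeSieve χ η := by
  intro ε hε
  set q : ℝ := (Fintype.card F : ℝ) with hq
  have hq1 : 1 < q := one_lt_card_real F
  have hq0 : 0 < q := by linarith
  set δ := ε / 5 with hδ
  have hδ0 : 0 < δ := by positivity
  obtain ⟨K₁, hK₁, h₁⟩ := h δ hδ0
  obtain ⟨K₂, hK₂, h₂⟩ := exists_pow_le_rpow hq1 1 hδ0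
  obtain ⟨C, hC, hdiv⟩ := exists_divisor_bound F hδ0
  refine ⟨1 + C ^ 3 * (q * 2 * K₂) * K₁, by
    have : 0 ≤ C ^ 3 * (q * 2 * K₂) * K₁ := by positivity
    linarith, fun m n hnm => ?_⟩
  have hnm' : (n : ℝ) ≤ m := by exact_mod_cast hnm
  set e : ℝ := max (max (m : ℝ) (2 * (m + n) / 3)) ((5 / 3 + 2 * η) * n - (1 / 3 + η) * m) with he
  have he0 : (m : ℝ) ≤ e := (le_max_left _ _).trans (le_max_left _ _)
  have he1 : 2 * ((m : ℝ) + n) / 3 ≤ e := (le_max_right _ _).trans (le_max_left _ _)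
  have he2 : (5 / 3 + 2 * η) * n - (1 / 3 + η) * m ≤ e := le_max_right _ _
  set Z : ℝ := K₁ * q ^ (δ * ((m : ℝ) + n) + e) with hZ
  have hZ0 : 0 ≤ Z := by positivity
  have hmain := sieveBound_of_poisson (m := m) (n := n) hχ hneg hZ0 (hdiv n) (by
    intro a k j _ han hkm hmk hjk
    have han' : (a : ℝ) ≤ n := by exact_mod_cast han
    have hkm' : (k : ℝ) ≤ m := by exact_mod_cast hkm
    have hmk' : (m : ℝ) + a ≤ n + k := by exact_mod_cast hmk
    have hjk' : (j : ℝ) + k ≤ 2 * a := by exact_mod_cast hjk.le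
    have hja' : (j : ℝ) ≤ a := by linarith
    refine (h₁ j a (by exact_mod_cast hja')).mono ?_
    rw [le_div_iff₀ (by positivity), ← hq, ← Real.rpow_natCast, ← Real.rpow_natCast, hZ, mul_assoc,
      mul_assoc, ← Real.rpow_add hq0, ← Real.rpow_add hq0]
    refine mul_le_mul_of_nonneg_left (Real.rpow_le_rpow_of_exponent_le hq1.le ?_) (by positivity)
    have h3 : δ * ((j : ℝ) + a) ≤ δ * ((m : ℝ) + n) :=
      mul_le_mul_of_nonneg_left (by linarith) hδ0.le
    have h4 : max ((a : ℝ) + j / 3) ((4 / 3 + η) * j) + k ≤ e + a := by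
      rw [← le_sub_iff_add_le]
      refine max_le (by linarith) ?_
      have h5 : (4 / 3 + η) * j ≤ (4 / 3 + η) * (2 * a - k) :=
        mul_le_mul_of_nonneg_left (by linarith) (by positivity)
      have h6 : (1 / 3 + η) * (m - k) ≤ (1 / 3 + η) * (n - a) :=
        mul_le_mul_of_nonneg_left (by linarith) (by positivity)
      have h7 : 0 ≤ (4 / 3 + η) * ((n : ℝ) - a) := mul_nonneg (by positivity) (by linarith)
      linarith
    linarith)
  refine hmain.mono ?_
  set Y : ℝ := C * q ^ (δ * n) with hY
  have hn1 : (n : ℝ) ≤ K₂ * q ^ (δ * n) := by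
    have := h₂ n
    rw [pow_one] at this
    linarith
  have hexp : Y ^ 3 * (q * (2 * n)) * Z ≤ C ^ 3 * (q * 2 * K₂) * K₁ * q ^ (ε * ((m : ℝ) + n) + e) := by
    calc Y ^ 3 * (q * (2 * n)) * Z ≤ Y ^ 3 * (q * (2 * (K₂ * q ^ (δ * n)))) * Z := by gcongr
      _ = C ^ 3 * (q * 2 * K₂) * K₁ *
          ((q ^ (δ * n)) ^ 3 * q ^ (δ * n) * q ^ (δ * ((m : ℝ) + n) + e)) := by
          rw [hY, hZ]; ring
      _ = C ^ 3 * (q * 2 * K₂) * K₁ *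
          q ^ (δ * n * 3 + δ * n + (δ * ((m : ℝ) + n) + e)) := by
          rw [Real.rpow_add hq0 (δ * n * 3 + δ * n), Real.rpow_add hq0 (δ * n * 3),
            Real.rpow_mul hq0.le (δ * n) 3]
          norm_cast
      _ ≤ _ := by
          refine mul_le_mul_of_nonneg_left (Real.rpow_le_rpow_of_exponent_le hq1.le ?_)
            (by positivity)
          have : ε = 5 * δ := by rw [hδ]; ring
          rw [this]
          have : 0 ≤ δ * (m : ℝ) := by positivity
          linarith
  have hfirst : q ^ m ≤ q ^ (ε * ((m : ℝ) + n) + e) := by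
    rw [← Real.rpow_natCast]
    refine Real.rpow_le_rpow_of_exponent_le hq1.le ?_
    have : 0 ≤ ε * ((m : ℝ) + n) := by positivity
    linarith
  rw [add_mul, one_mul]
  exact add_le_add hfirst hexp

/-- Lengthening the outer sum to the point where the dual contribution is balanced improves the
excess by the factor `2 / 3`. -/
lemma LongLargeSieve.sqfree {η : ℝ} (hη : 0 ≤ η) (hneg : χ (-1) = 1)
    (h : LongLargeSieve χ η) : SqfreeLargeSieve χ (2 / 3 * η) := by
  suffices H : ∀ ε : ℝ, 0 < ε → ∃ K : ℝ, 1 ≤ K ∧ ∀ m n : ℕ, n ≤ m →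
      SieveBound χ (sqfreeDeg F m) n
        (K * (Fintype.card F : ℝ) ^ (ε * (m + n) + sqfreeExponent (2 / 3 * η) m n)) by
    intro ε hε
    obtain ⟨K, hK, hb⟩ := H ε hε
    refine ⟨K, hK, fun m n => ?_⟩
    rcases le_total n m with hnm | hmn
    · exact hb m n hnm
    · have := (hb n m hmn).swap hneg (by positivity)
      rw [add_comm (n : ℝ) m] at this
      have hs : sqfreeExponent (2 / 3 * η) n m = sqfreeExponent (2 / 3 * η) m n := by
        simp only [sqfreeExponent]
        rw [max_comm (n : ℝ) m, add_comm (n : ℝ) m, min_comm (n : ℝ) m]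
      rwa [hs] at this
  intro ε hε
  set q : ℝ := (Fintype.card F : ℝ) with hq
  have hq1 : 1 < q := one_lt_card_real F
  have hq0 : 0 < q := by linarith
  set δ := min (ε / 3) 1 with hδ
  have hδ0 : 0 < δ := lt_min (by positivity) one_pos
  have hδε : 3 * δ ≤ ε := by
    have := min_le_left (ε / 3) 1
    linarith
  have hδ1 : δ ≤ 1 := min_le_right _ _
  obtain ⟨K₁, hK₁, h₁⟩ := h δ hδ0
  obtain ⟨K₂, hK₂, h₂⟩ := exists_pow_le_rpow hq1 3 hδ0
  refine ⟨q ^ 3 * K₂ * K₁, by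
    have := one_le_pow₀ (n := 3) hq1.le
    nlinarith [mul_le_mul this hK₂ zero_le_one (by positivity)], fun m n hnm => ?_⟩
  have hnm' : (n : ℝ) ≤ m := by exact_mod_cast hnm
  have hn0 : (0 : ℝ) ≤ n := Nat.cast_nonneg n
  -- the least `y` with `n < q ^ y`; the lengthening `x` has to be a multiple of it
  set y := Nat.log (Fintype.card F) n + 1 with hy
  have hny : n < Fintype.card F ^ y := Nat.lt_pow_succ_log_self Fintype.one_lt_card n
  have hqy : q ^ y ≤ q * ((n : ℝ) + 1) := by
    rw [hy, pow_succ, mul_comm]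
    refine mul_le_mul_of_nonneg_left ?_ hq0.le
    have : Fintype.card F ^ Nat.log (Fintype.card F) n ≤ n + 1 := by
      rcases eq_or_ne n 0 with rfl | hn
      · simp
      · exact (Nat.pow_log_le_self _ hn).trans (Nat.le_succ n)
    rw [hq]; exact_mod_cast this
  -- `n + n * w` is the length at which the dual term is as small as the other two
  set w : ℝ := η / (1 + η) with hw
  have hw0 : 0 ≤ w := by positivity
  have hw1 : w ≤ 1 := by rw [hw, div_le_one (by positivity)]; linarith
  have hwη : w ≤ η := div_le_self hη (by linarith)
  have hwe : w * (1 + η) = η := by rw [hw]; field_simp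
  set u : ℝ := n + n * w with hu
  have hy0 : (0 : ℝ) < y := by rw [hy]; positivity
  set x := y * ⌈max 0 (u - m) / y⌉₊ with hx
  have hx1 : max 0 (u - m) ≤ x := by
    have := Nat.le_ceil (max 0 (u - m) / y)
    rw [div_le_iff₀ hy0] at this
    rw [hx]; push_cast; linarith
  have hx2 : (x : ℝ) ≤ max 0 (u - m) + y := by
    have := (Nat.ceil_lt_add_one (div_nonneg (le_max_left 0 (u - m)) hy0.le)).le
    have h3 := mul_le_mul_of_nonneg_left this hy0.le
    rw [hx]; push_cast
    refine h3.trans (le_of_eq ?_)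
    field_simp
  have hMu : u ≤ m + x := by linarith [le_max_right 0 (u - m)]
  have hx0 : (0 : ℝ) ≤ x := Nat.cast_nonneg x
  have hb := sieveBound_of_add (m := m) (by omega) hny ⟨_, hx⟩
    (h₁ (m + x) n (by omega))
  refine hb.mono ?_
  push_cast
  set E := sqfreeExponent (2 / 3 * η) m n with hE
  have hE1 : (m : ℝ) ≤ E := (le_max_left _ _).trans (le_max_left _ _)
  have hE2 : 2 * ((m : ℝ) + n) / 3 ≤ E := (le_max_left _ _).trans (le_max_right _ _)
  have hE3 : (4 / 3 + 2 / 3 * η) * n ≤ E := by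
    refine le_trans (le_of_eq ?_) ((le_max_right _ _).trans (le_max_right _ _))
    rw [min_eq_right hnm']
  have hnw : n * w ≤ n * 1 := mul_le_mul_of_nonneg_left hw1 hn0
  have hnwη : n * w ≤ n * η := mul_le_mul_of_nonneg_left hwη hn0
  have hxm : (m : ℝ) + x ≤ max (m : ℝ) u + y := by
    rcases le_total (m : ℝ) u with h3 | h3
    · rw [max_eq_right h3]
      rw [max_eq_right (by linarith)] at hx2
      linarith
    · rw [max_eq_left h3]
      rw [max_eq_left (by linarith)] at hx2
      linarith
  have hA : max (m : ℝ) u ≤ E := max_le hE1 (by linarith)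
  have hB : 2 * (max (m : ℝ) u + n) / 3 ≤ E := by
    rcases le_total (m : ℝ) u with h3 | h3
    · rw [max_eq_right h3]; linarith
    · rw [max_eq_left h3]; linarith
  have hL : max (m : ℝ) u ≤ m + n := max_le (by linarith) (by linarith)
  have hmax : max (max ((m : ℝ) + x) (2 * ((m : ℝ) + x + n) / 3))
      ((5 / 3 + 2 * η) * n - (1 / 3 + η) * (m + x)) ≤ E + y := by
    refine max_le (max_le (by linarith) (by linarith)) ?_
    have h3 : (1 + η) * u = (1 + 2 * η) * n := by rw [hu]; linear_combination (n : ℝ) * hwe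
    have h4 : (1 + η) * u ≤ (1 + η) * (m + x) := mul_le_mul_of_nonneg_left hMu (by linarith)
    linarith
  have hexp : δ * ((m : ℝ) + x + n) ≤ 2 * δ * ((m : ℝ) + n) + y := by
    have h3 : δ * ((m : ℝ) + x + n) ≤ δ * (2 * ((m : ℝ) + n) + y) :=
      mul_le_mul_of_nonneg_left (by linarith) hδ0.le
    have h4 : δ * (y : ℝ) ≤ 1 * y := mul_le_mul_of_nonneg_right hδ1 hy0.le
    linarith
  calc q ^ y * (K₁ * q ^ (δ * ((m : ℝ) + x + n) + max (max ((m : ℝ) + x) (2 * ((m : ℝ) + x + n) / 3))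
      ((5 / 3 + 2 * η) * n - (1 / 3 + η) * (m + x))))
      ≤ q ^ y * (K₁ * q ^ ((y : ℝ) + y + (2 * δ * ((m : ℝ) + n) + E))) := by
        refine mul_le_mul_of_nonneg_left (mul_le_mul_of_nonneg_left
          (Real.rpow_le_rpow_of_exponent_le hq1.le ?_) (by positivity)) (by positivity)
        linarith
    _ = (q ^ y) ^ 3 * (K₁ * q ^ (2 * δ * ((m : ℝ) + n) + E)) := by
        rw [Real.rpow_add hq0, Real.rpow_add hq0, Real.rpow_natCast]; ring
    _ ≤ (q * ((n : ℝ) + 1)) ^ 3 * (K₁ * q ^ (2 * δ * ((m : ℝ) + n) + E)) := by gcongr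
    _ = q ^ 3 * ((n : ℝ) + 1) ^ 3 * (K₁ * q ^ (2 * δ * ((m : ℝ) + n) + E)) := by rw [mul_pow]
    _ ≤ q ^ 3 * (K₂ * q ^ (δ * n)) * (K₁ * q ^ (2 * δ * ((m : ℝ) + n) + E)) := by
        gcongr
        exact h₂ n
    _ = q ^ 3 * K₂ * K₁ * q ^ (δ * n + (2 * δ * ((m : ℝ) + n) + E)) := by
        rw [Real.rpow_add hq0 (δ * n)]; ring
    _ ≤ _ := by
        refine mul_le_mul_of_nonneg_left (Real.rpow_le_rpow_of_exponent_le hq1.le ?_)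
          (by positivity)
        have h3 : 3 * δ * ((m : ℝ) + n) ≤ ε * (m + n) :=
          mul_le_mul_of_nonneg_right hδε (by positivity)
        have h4 : 0 ≤ δ * (m : ℝ) := by positivity
        linarith

lemma sqfreeLargeSieve_iterate (hχ : χ ≠ 1) (hχ2 : χ ^ 2 ≠ 1) (hneg : χ (-1) = 1) (k : ℕ) :
    SqfreeLargeSieve χ ((2 / 3) ^ k * (5 / 3)) := by
  induction k with
  | zero => simpa using sqfreeLargeSieve_base hχ hneg
  | succ k ih =>
    have := ((ih.short (by positivity) hχ2 hneg).long (by positivity) hχ hneg).sqfree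
      (by positivity) hneg
    rwa [← mul_assoc, ← pow_succ'] at this

/-- The large sieve inequality for the symbols attached to a character of order at least `3`. -/
theorem exists_largeSieve_symb (hχ : χ ≠ 1) (hχ2 : χ ^ 2 ≠ 1) (hneg : χ (-1) = 1) {ε : ℝ}
    (hε : 0 < ε) : ∃ K : ℝ, 0 < K ∧ ∀ m n : ℕ, SieveBound χ (monicDeg F m) n
      (K * (Fintype.card F : ℝ) ^ (ε * ((m : ℝ) + (n : ℝ))) *
            ((Fintype.card F : ℝ) ^ (m : ℝ) +
              (Fintype.card F : ℝ) ^ ((n : ℝ) + (m : ℝ) / 3) +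
              (Fintype.card F : ℝ) ^ (2 * ((m : ℝ) + (n : ℝ)) / 3))) := by
  set q : ℝ := (Fintype.card F : ℝ) with hq
  have hq1 : 1 < q := one_lt_card_real F
  have hq0 : 0 < q := by linarith
  obtain ⟨k, hk⟩ := exists_pow_lt_of_lt_one (show (0 : ℝ) < ε / 2 * (3 / 5) by positivity)
    (show (2 / 3 : ℝ) < 1 by norm_num)
  set η : ℝ := (2 / 3) ^ k * (5 / 3) with hη
  have hη0 : 0 ≤ η := by positivity
  have hηε : η ≤ ε / 2 := by rw [hη]; linarith
  have hs := (sqfreeLargeSieve_iterate hχ hχ2 hneg k).short hη0 hχ2 hneg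
  obtain ⟨K₁, hK₁, h₁⟩ := hs (ε / 2) (by positivity)
  obtain ⟨K₂, hK₂, h₂⟩ := hs.long hη0 hχ hneg (ε / 2) (by positivity)
  refine ⟨K₁ + K₂, by linarith, fun m n => ?_⟩
  have hm0 : (0 : ℝ) ≤ m := Nat.cast_nonneg m
  have hn0 : (0 : ℝ) ≤ n := Nat.cast_nonneg n
  set T : ℝ := q ^ (m : ℝ) + q ^ ((n : ℝ) + (m : ℝ) / 3) + q ^ (2 * ((m : ℝ) + (n : ℝ)) / 3) with hT
  have hp1 : 0 < q ^ (m : ℝ) := by positivity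
  have hp2 : 0 < q ^ ((n : ℝ) + (m : ℝ) / 3) := by positivity
  have hp3 : 0 < q ^ (2 * ((m : ℝ) + (n : ℝ)) / 3) := by positivity
  have key : ∀ (K f g : ℝ), 0 ≤ K → K ≤ K₁ + K₂ → q ^ g ≤ T →
      f ≤ ε / 2 * ((m : ℝ) + n) + g →
      K * q ^ (ε / 2 * ((m : ℝ) + n) + f) ≤ (K₁ + K₂) * q ^ (ε * ((m : ℝ) + n)) * T := by
    intro K f g hK0 hK hg hf
    calc K * q ^ (ε / 2 * ((m : ℝ) + n) + f) ≤ K * q ^ (ε * ((m : ℝ) + n) + g) := by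
          refine mul_le_mul_of_nonneg_left (Real.rpow_le_rpow_of_exponent_le hq1.le ?_) hK0
          linarith
      _ = K * q ^ (ε * ((m : ℝ) + n)) * q ^ g := by rw [Real.rpow_add hq0, mul_assoc]
      _ ≤ _ := by gcongr
  rcases le_total n m with hnm | hmn
  · have hnm' : (n : ℝ) ≤ m := by exact_mod_cast hnm
    refine (h₂ m n hnm).mono (key _ _ (max (m : ℝ) (2 * ((m : ℝ) + n) / 3)) (by linarith)
      (by linarith) ?_ ?_)
    · rcases le_total (m : ℝ) (2 * ((m : ℝ) + n) / 3) with h | h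
      · rw [max_eq_right h]; linarith
      · rw [max_eq_left h]; linarith
    · have h3 : η * n ≤ ε / 2 * n := mul_le_mul_of_nonneg_right hηε hn0
      have h4 : η * n ≤ η * m := mul_le_mul_of_nonneg_left hnm' hη0
      have h5 : 0 ≤ ε / 2 * (m : ℝ) := by positivity
      have h6 : 0 ≤ ε / 2 * (n : ℝ) := by positivity
      refine max_le (by linarith) ?_
      have := le_max_right (m : ℝ) (2 * ((m : ℝ) + n) / 3)
      linarith
  · have hmn' : (m : ℝ) ≤ n := by exact_mod_cast hmn
    refine (h₁ m n hmn).mono (key _ _ ((n : ℝ) + m / 3) (by linarith) (by linarith)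
      (by linarith) ?_)
    have h3 : η * m ≤ ε / 2 * m := mul_le_mul_of_nonneg_right hηε hm0
    have h5 : 0 ≤ ε / 2 * (m : ℝ) := by positivity
    have h6 : 0 ≤ ε / 2 * (n : ℝ) := by positivity
    exact max_le (by linarith) (by linarith)

end Iteration

end LargeSieve

open LargeSieve in
theorem theorem1p4 {F : Type*} [Field F] [Fintype F] (ℓ : ℕ) (hℓ : 3 ≤ ℓ)
    (hq : Fintype.card F ≡ 1 [MOD 2 * ℓ]) (ε : ℝ) (hε : 0 < ε) :
    ∃ K : ℝ, 0 < K ∧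
      ∀ (Ω : rootsOfUnity ℓ F ≃* rootsOfUnity ℓ ℂ) (m n : ℕ) (lam : Polynomial F → ℂ),
        ∑ M ∈ monicDeg F m, ‖∑ N ∈ sqfreeDeg F n, lam N * residueSymbol Ω M N‖ ^ 2 ≤
          K * (Fintype.card F : ℝ) ^ (ε * ((m : ℝ) + (n : ℝ))) *
            ((Fintype.card F : ℝ) ^ (m : ℝ) +
              (Fintype.card F : ℝ) ^ ((n : ℝ) + (m : ℝ) / 3) +
              (Fintype.card F : ℝ) ^ (2 * ((m : ℝ) + (n : ℝ)) / 3)) *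
            ∑ N ∈ sqfreeDeg F n, ‖lam N‖ ^ 2 := by
  have hdvd : 2 * ℓ ∣ Fintype.card F - 1 :=
    (Nat.modEq_iff_dvd' Fintype.card_pos).1 hq.symm
  have hdvd' : ℓ ∣ Fintype.card F - 1 := (dvd_mul_left ℓ 2).trans hdvd
  have hq' : Fintype.card F ≡ 1 [MOD ℓ] := hq.of_mul_left 2
  have hne : ∀ (Ω : rootsOfUnity ℓ F ≃* rootsOfUnity ℓ ℂ) (j : ℕ), 0 < j → j < 3 →
      residueChar hdvd' Ω ^ j ≠ 1 := fun Ω j h1 h2 =>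
    residueChar_pow_ne_one hdvd' Ω fun h => by
      have := Nat.le_of_dvd h1 h
      omega
  choose K hK h using fun Ω : rootsOfUnity ℓ F ≃* rootsOfUnity ℓ ℂ =>
    exists_largeSieve_symb (by simpa using hne Ω 1 one_pos (by norm_num))
      (hne Ω 2 two_pos (by norm_num)) (residueChar_neg_one hdvd Ω) hε
  -- there are only finitely many `Ω`, so that the constant can be chosen independently of `Ω`
  have : NeZero ℓ := ⟨by omega⟩
  have : Finite (rootsOfUnity ℓ F ≃* rootsOfUnity ℓ ℂ) := DFunLike.finite _
  have := Fintype.ofFinite (rootsOfUnity ℓ F ≃* rootsOfUnity ℓ ℂ)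
  have hsum : ∀ Ω, K Ω ≤ 1 + ∑ Ω', K Ω' := fun Ω => by
    have := Finset.single_le_sum (fun Ω' _ => (hK Ω').le) (Finset.mem_univ Ω)
    linarith
  refine ⟨1 + ∑ Ω, K Ω, by
    have : 0 ≤ ∑ Ω, K Ω := Finset.sum_nonneg fun Ω _ => (hK Ω).le
    linarith, fun Ω m n lam => ?_⟩
  refine le_trans (le_of_eq ?_) (((h Ω m n).mono ?_) lam)
  · refine Finset.sum_congr rfl fun M _ => ?_
    congr 2
    refine Finset.sum_congr rfl fun N hN => ?_
    rw [residueSymbol_eq_symb (by omega) hq' hdvd' Ω M (mem_sqfreeDeg.1 hN).1.1]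
  · have := hsum Ω
    gcongr
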